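/- Let $F$ be a free group (of arbitrary rank), and let $H$ and $K$ be nontrivial finitely generated subgroups of $F$, of ranks $h$ and $k$ respectively, with $h \leq k$ and $H \cap K \neq 1$. Let $H \vee K = \langle H, K\rangle$ denote the subgroup of $F$ generated by $H \cup K$. Then $H \cap K$ and $H \vee K$ are finitely generated, and $$\mathrm{rank}(H\cap K) - 1 \;\leq\; 2(h-1)(k-1) - (h-1)\bigl(\mathrm{rank}(H\vee K) - 1\bigr).$$ Here the rank of a finitely generated free group is the number of elements of a free basis, equivalently the smallest number of elements in a generating set. -/

import Mathlib

open Module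

/-! Write I for H ∩ K. After passing to a free group on generators and conjugating, I contains a
nontrivial cyclically reduced word. Let Γ_H, Γ_K, Γ_I be the finite graphs swept out by reduced
loops at the base points of the coset spaces of H and K and of their product. All degrees are at
least 2, and the sum of (degree − 2) is 2(rank − 1) for each graph. Γ_I projects to Γ_H and to Γ_K;
let Γ be the connected graph obtained from Γ_H ⊔ Γ_K by identifying the two images of each vertex
and dart of Γ_I.

Topological input (`finrank_ratChars_sup_le`): a rational character of H ∨ K is determined by its
restrictions to H and K, and this pair is given by integrating a function on the edges of Γ, with
coboundaries integrating to zero. Hence rank(H ∨ K) − 1 ≤ −χ(Γ). Ranks appear throughout as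
dimensions of spaces of characters, and vertices and darts of Γ are counted as dimensions of spaces
of functions.

Combinatorial input: order the letters linearly and discard the least and the greatest dart at every
vertex. The remaining inner darts form sets A of size 2(h−1), B of size 2(k−1), and a set of size
2(rank I − 1) for Γ_I; the last embeds in A × B, because an inner dart of Γ_I is inner in both
projections. Let Q be the set of classes of A ⊔ B generated by these pairs. A submodularity argument
(`sum_finrank_agreeOn_le`, `sum_finrank_agreeOn_le_card_quot`) gives −2χ(Γ) ≤ |Q|.

Arithmetic (`sum_mul_add_le`): if class q has a_q elements in A and b_q in B, then |A| ≤ |B| and 2j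
≤ |Q| imply Σ a_q b_q + |A| j ≤ |A||B|. Taking j = rank(H ∨ K) − 1 gives twice the desired
inequality. -/

/-- Functions on `V` taking equal values at the two ends of every link in `E`. -/
def agree {V ι : Type*} (a b : ι → V) (E : Set ι) : Submodule ℚ (V → ℚ) where
  carrier := {u | ∀ i ∈ E, u (a i) = u (b i)}
  add_mem' := fun hu hv i hi => by simp [hu i hi, hv i hi]
  zero_mem' := fun _ _ => rfl
  smul_mem' := fun c u hu i hi => by simp [hu i hi]

/-- Functions on `V` supported on `S` and taking equal values at the two ends of every link
in `E`. -/
def agreeOn {V ι : Type*} (a b : ι → V) (S : Set V) (E : Set ι) : Submodule ℚ (V → ℚ) where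
  carrier := {u | (∀ v, v ∉ S → u v = 0) ∧ ∀ i ∈ E, u (a i) = u (b i)}
  add_mem' := fun hu hv =>
    ⟨fun v h => by simp [hu.1 v h, hv.1 v h], fun i hi => by simp [hu.2 i hi, hv.2 i hi]⟩
  zero_mem' := ⟨fun _ _ => rfl, fun _ _ => rfl⟩
  smul_mem' := fun c u hu => ⟨fun v h => by simp [hu.1 v h], fun i hi => by simp [hu.2 i hi]⟩

/-! ### Dimensions of spaces of functions constant along links -/

section Agree

variable {V ι : Type*} {a b : ι → V}

theorem mem_agree {E : Set ι} {u : V → ℚ} :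
    u ∈ agree a b E ↔ ∀ i ∈ E, u (a i) = u (b i) := Iff.rfl

theorem agree_antitone {E₁ E₂ : Set ι} (h : E₁ ⊆ E₂) : agree a b E₂ ≤ agree a b E₁ :=
  fun _ hu i hi => hu i (h hi)

theorem agree_union (E₁ E₂ : Set ι) : agree a b (E₁ ∪ E₂) = agree a b E₁ ⊓ agree a b E₂ := by
  ext u
  simp only [Submodule.mem_inf, mem_agree, Set.mem_union]
  exact ⟨fun h => ⟨fun i hi => h i (Or.inl hi), fun i hi => h i (Or.inr hi)⟩,
    fun h i hi => hi.elim (h.1 i) (h.2 i)⟩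

theorem agree_empty : agree a b (∅ : Set ι) = ⊤ := by
  ext u
  simp [mem_agree]

/-- The codimension of `agree` is submodular in the set of links. -/
theorem finrank_agree_submodular [Finite V] {E₁ E₂ : Set ι} (h : E₁ ⊆ E₂) (M : Set ι) :
    finrank ℚ (agree a b (E₁ ∪ M)) + finrank ℚ (agree a b E₂) ≤
      finrank ℚ (agree a b (E₂ ∪ M)) + finrank ℚ (agree a b E₁) := by
  -- The dimension formula for two subspaces: their intersection is the space for `E₂ ∪ M`, and
  -- their sum only has to lie inside the space for `E₁`.
  have h₁ := Submodule.finrank_sup_add_finrank_inf_eq (agree a b (E₁ ∪ M)) (agree a b E₂)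
  have h₂ : agree a b (E₁ ∪ M) ⊓ agree a b E₂ = agree a b (E₂ ∪ M) := by
    rw [← agree_union]
    congr 1
    ext i
    have := @h i
    simp only [Set.mem_union]
    tauto
  have h₃ : agree a b (E₁ ∪ M) ⊔ agree a b E₂ ≤ agree a b E₁ :=
    sup_le (agree_antitone Set.subset_union_left) (agree_antitone h)
  have h₄ := Submodule.finrank_mono h₃
  rw [h₂] at h₁
  omega

/-- Adding the links with marker `l` to sets of links whose markers are smaller than `l`
costs, in total over `l`, at least the codimension of the space for all links. -/
theorem sum_finrank_agree_filtration {L : Type*} [LinearOrder L] [Fintype V] (m : ι → L)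
    (Λ : Finset L) (E : L → Set ι) (hE : ∀ l ∈ Λ, ∀ i ∈ E l, m i < l ∧ m i ∈ Λ) :
    ∑ l ∈ Λ, finrank ℚ (agree a b (E l ∪ {i | m i = l})) + Fintype.card V ≤
      ∑ l ∈ Λ, finrank ℚ (agree a b (E l)) + finrank ℚ (agree a b {i | m i ∈ Λ}) := by
  induction Λ using Finset.induction_on_max with
  | empty =>
    have : {i | m i ∈ (∅ : Finset L)} = (∅ : Set ι) := by ext; simp
    rw [this, agree_empty]
    simp
  | insert x s hx ih =>
    have hxs : x ∉ s := fun h => lt_irrefl _ (hx x h)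
    rw [Finset.sum_insert hxs, Finset.sum_insert hxs]
    have ih' := ih fun l hl i hi => by
      obtain ⟨h₁, h₂⟩ := hE l (Finset.mem_insert_of_mem hl) i hi
      refine ⟨h₁, (Finset.mem_insert.1 h₂).resolve_left ?_⟩
      exact (h₁.trans (hx l hl)).ne
    have hsub : E x ⊆ {i | m i ∈ s} := fun i hi => by
      obtain ⟨h₁, h₂⟩ := hE x (Finset.mem_insert_self _ _) i hi
      exact (Finset.mem_insert.1 h₂).resolve_left h₁.ne
    -- Adding the links marked `x` to `E x` lowers the dimension at least as much as adding them to
    -- all links with smaller markers; the latter drops telescope.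
    have hs := finrank_agree_submodular (a := a) (b := b) hsub {i | m i = x}
    have hu : {i | m i ∈ s} ∪ {i | m i = x} = {i | m i ∈ insert x s} := by
      ext i
      simp [or_comm]
    rw [hu] at hs
    omega

/-- No link of `E` touches a vertex outside `S`, so the values there are free; setting them to zero
costs exactly their number. -/
theorem finrank_agreeOn [Fintype V] {S : Set V} {E : Set ι} (h : ∀ i ∈ E, a i ∈ S ∧ b i ∈ S) :
    finrank ℚ (agreeOn a b S E) + Fintype.card V = finrank ℚ (agree a b E) + S.ncard := by
  classical
  let r : agree a b E →ₗ[ℚ] ({v // v ∉ S} → ℚ) :=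
    { toFun := fun u v => u.1 v.1
      map_add' := fun _ _ => rfl
      map_smul' := fun _ _ => rfl }
  have hr : Function.Surjective r := fun g => by
    refine ⟨⟨fun v => if hv : v ∈ S then 0 else g ⟨v, hv⟩, fun i hi => ?_⟩, ?_⟩
    · simp [h i hi]
    · ext v
      simp [r, v.2]
  have h₁ := LinearMap.finrank_range_add_finrank_ker r
  rw [LinearMap.range_eq_top.2 hr, finrank_top, Module.finrank_fintype_fun_eq_card] at h₁
  have h₂ : finrank ℚ (LinearMap.ker r) = finrank ℚ (agreeOn a b S E) := by
    refine LinearEquiv.finrank_eq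
      { toFun := fun u => ⟨u.1.1, fun v hv => congrFun (LinearMap.mem_ker.1 u.2) ⟨v, hv⟩, u.1.2⟩
        invFun := fun u => ⟨⟨u.1, u.2.2⟩, LinearMap.mem_ker.2 (funext fun v => u.2.1 v.1 v.2)⟩
        map_add' := fun _ _ => rfl
        map_smul' := fun _ _ => rfl
        left_inv := fun _ => rfl
        right_inv := fun _ => rfl }
  have h₃ : Fintype.card {v // v ∉ S} + S.ncard = Fintype.card V := by
    rw [Fintype.card_subtype_compl, ← Nat.card_coe_set_eq, Nat.card_eq_fintype_card]
    exact Nat.sub_add_cancel (Fintype.card_subtype_le _)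
  omega

/-- Comparison of spaces of supported functions along a map of the vertices. -/
theorem finrank_agreeOn_le_of_map [Finite V] {S S' : Set V} {E E' : Set ι} (σ : V → V)
    (hσ : ∀ v' ∈ S', ∃ v ∈ S, σ v = v')
    (hE : ∀ i ∈ E, a i ∈ S ∧ b i ∈ S ∧ ∃ i' ∈ E', a i' = σ (a i) ∧ b i' = σ (b i)) :
    finrank ℚ (agreeOn a b S' E') ≤ finrank ℚ (agreeOn a b S E) := by
  classical
  let p : agreeOn a b S' E' →ₗ[ℚ] agreeOn a b S E :=
    { toFun := fun u => ⟨fun v => if v ∈ S then u.1 (σ v) else 0, fun v hv => if_neg hv,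
        fun i hi => by
          obtain ⟨h₁, h₂, j, hj, h₃, h₄⟩ := hE i hi
          simp only [h₁, h₂, if_true, ← h₃, ← h₄]
          exact u.2.2 j hj⟩
      map_add' := fun u v => by ext w; by_cases hw : w ∈ S <;> simp [hw]
      map_smul' := fun c u => by ext w; by_cases hw : w ∈ S <;> simp [hw] }
  refine LinearMap.finrank_le_finrank_of_injective (f := p) ?_
  rw [← LinearMap.ker_eq_bot, LinearMap.ker_eq_bot']
  intro u hu
  ext v'
  by_cases hv' : v' ∈ S'
  · obtain ⟨v, hv, rfl⟩ := hσ v' hv'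
    have := congrFun (congrArg Subtype.val hu) v
    simpa [p, hv] using this
  · exact u.2.1 v' hv'

end Agree

/-! ### Inner letters and the estimate for glued stars -/

/-- The elements of a finite set other than its extrema. -/
def Finset.inner {L : Type*} [LinearOrder L] (D : Finset L) : Finset L :=
  D.filter fun l => (∃ m ∈ D, m < l) ∧ ∃ m ∈ D, l < m

theorem Finset.mem_inner {L : Type*} [LinearOrder L] {D : Finset L} {l : L} :
    l ∈ D.inner ↔ l ∈ D ∧ (∃ m ∈ D, m < l) ∧ ∃ m ∈ D, l < m := by
  simp [Finset.inner]

theorem Finset.inner_mono {L : Type*} [LinearOrder L] {D D' : Finset L} (h : D ⊆ D') :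
    D.inner ⊆ D'.inner := fun l hl => by
  obtain ⟨h₁, ⟨m, hm, hml⟩, n, hn, hln⟩ := Finset.mem_inner.1 hl
  exact Finset.mem_inner.2 ⟨h h₁, ⟨m, h hm, hml⟩, n, h hn, hln⟩

theorem Finset.card_inner {L : Type*} [LinearOrder L] {D : Finset L} (h : 2 ≤ D.card) :
    D.inner.card + 2 = D.card := by
  have hne : D.Nonempty := Finset.card_pos.1 (by omega)
  have hlt : D.min' hne < D.max' hne :=
    Finset.min'_lt_max'_of_card _ (by omega)
  have : D.inner = (D.erase (D.min' hne)).erase (D.max' hne) := by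
    ext l
    simp only [Finset.mem_inner, Finset.mem_erase]
    constructor
    · rintro ⟨h₁, ⟨m, hm, hml⟩, n, hn, hln⟩
      exact ⟨(hln.trans_le (D.le_max' n hn)).ne, ((D.min'_le m hm).trans_lt hml).ne', h₁⟩
    · rintro ⟨h₁, h₂, h₃⟩
      exact ⟨h₃, ⟨_, D.min'_mem hne, lt_of_le_of_ne (D.min'_le l h₃) h₂.symm⟩,
        _, D.max'_mem hne, lt_of_le_of_ne (D.le_max' l h₃) h₁⟩
  rw [this, Finset.card_erase_of_mem, Finset.card_erase_of_mem (D.min'_mem hne)]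
  · omega
  · exact Finset.mem_erase.2 ⟨hlt.ne', D.max'_mem hne⟩

theorem Finset.sum_ncard_setOf_mem {V L : Type*} [Fintype V] (Λ : Finset L)
    (D : V → Finset L) (hD : ∀ v, D v ⊆ Λ) :
    ∑ l ∈ Λ, {v | l ∈ D v}.ncard = ∑ v, (D v).card := by
  classical
  have h := Finset.sum_card_bipartiteAbove_eq_sum_card_bipartiteBelow (s := Λ)
    (t := (Finset.univ : Finset V)) (fun l v => l ∈ D v)
  convert h using 2 with l hl v hv
  · rw [← Set.ncard_coe_finset]
    congr 1
    ext v
    simp [Finset.bipartiteAbove]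
  · congr 1
    ext l
    simp only [Finset.bipartiteBelow, Finset.mem_filter]
    exact ⟨fun h => ⟨hD v h, h⟩, fun h => h.2⟩

/-- Euler characteristic estimate for a graph glued from stars: the stars are indexed by `V`, with
rays `D v`, and a link `i` glues the stars at `a i` and `b i` along the rays in `N i`. -/
theorem sum_finrank_agreeOn_le {V ι L : Type*} [Fintype V] [LinearOrder L] {a b : ι → V}
    (Λ : Finset L) (D : V → Finset L) (N : ι → Finset L) (hD : ∀ v, D v ⊆ Λ)
    (hD₂ : ∀ v, 2 ≤ (D v).card) (hN₂ : ∀ i, 2 ≤ (N i).card)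
    (ha : ∀ i, N i ⊆ D (a i)) (hb : ∀ i, N i ⊆ D (b i)) :
    ∑ l ∈ Λ, finrank ℚ (agreeOn a b {v | l ∈ D v} {i | l ∈ N i}) ≤
      ∑ l ∈ Λ, finrank ℚ (agreeOn a b {v | l ∈ (D v).inner} {i | l ∈ (N i).inner}) +
        2 * finrank ℚ (agree a b Set.univ) := by
  have hne : ∀ i, (N i).Nonempty := fun i => Finset.card_pos.1 (by have := hN₂ i; omega)
  have hNΛ : ∀ i, N i ⊆ Λ := fun i => (ha i).trans (hD _)
  have hlt : ∀ i, (N i).min' (hne i) < (N i).max' (hne i) := fun i =>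
    Finset.min'_lt_max'_of_card _ (hN₂ i)
  -- For each `l`, the links carrying `l` are reached from those with `l` inner in two stages: add
  -- the links with minimum `l`, then those with maximum `l`. Each stage, summed over `l`, lowers
  -- the dimension by at least `card V` minus the dimension for all links.
  have f₁ := sum_finrank_agree_filtration (a := a) (b := b) (fun i => (N i).min' (hne i)) Λ
    (fun l => {i | l ∈ (N i).inner}) fun l _ i hi => by
      obtain ⟨-, ⟨m, hm, hml⟩, -⟩ := Finset.mem_inner.1 hi
      exact ⟨((N i).min'_le m hm).trans_lt hml, hNΛ i ((N i).min'_mem _)⟩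
  -- The order is reversed for the second stage: the links already present at `l` have their maximum
  -- above `l`. For those with minimum `l` this uses that `N i` has two elements.
  have f₂ := sum_finrank_agree_filtration (L := Lᵒᵈ) (a := a) (b := b)
    (fun i => (N i).max' (hne i)) Λ
    (fun l => {i | l ∈ (N i).inner} ∪ {i | (N i).min' (hne i) = l}) fun l _ i hi => by
      refine ⟨?_, hNΛ i ((N i).max'_mem _)⟩
      rcases hi with hi | hi
      · obtain ⟨-, -, ⟨m, hm, hml⟩⟩ := Finset.mem_inner.1 hi
        exact (lt_of_lt_of_le hml ((N i).le_max' m hm) : @LT.lt L _ l _)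
      · have hi' : (N i).min' (hne i) = l := hi
        exact hi' ▸ hlt i
  have e₁ : {i | (N i).min' (hne i) ∈ Λ} = Set.univ :=
    Set.eq_univ_of_forall fun i => hNΛ i ((N i).min'_mem _)
  have e₂ : {i | (N i).max' (hne i) ∈ Λ} = Set.univ :=
    Set.eq_univ_of_forall fun i => hNΛ i ((N i).max'_mem _)
  have e₃ : ∀ l, {i | l ∈ (N i).inner} ∪ {i | (N i).min' (hne i) = l} ∪
      {i | (N i).max' (hne i) = l} = {i | l ∈ N i} := by
    intro l
    ext i
    simp only [Set.mem_union, Set.mem_ofPred_eq, Finset.mem_inner]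
    constructor
    · rintro ((h | h) | h)
      · exact h.1
      · exact h ▸ (N i).min'_mem _
      · exact h ▸ (N i).max'_mem _
    · intro h
      by_cases h₁ : (N i).min' (hne i) = l
      · exact Or.inl (Or.inr h₁)
      by_cases h₂ : (N i).max' (hne i) = l
      · exact Or.inr h₂
      exact Or.inl (Or.inl ⟨h, ⟨_, (N i).min'_mem _, lt_of_le_of_ne ((N i).min'_le l h) h₁⟩,
        _, (N i).max'_mem _, lt_of_le_of_ne ((N i).le_max' l h) (Ne.symm h₂)⟩)
  rw [e₁] at f₁
  have f₂' : ∑ l ∈ Λ, finrank ℚ (agree a b {i | l ∈ N i}) + Fintype.card V ≤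
      ∑ l ∈ Λ, finrank ℚ (agree a b ({i | l ∈ (N i).inner} ∪ {i | (N i).min' (hne i) = l})) +
        finrank ℚ (agree a b Set.univ) := by
    refine (le_of_eq ?_).trans (f₂.trans (le_of_eq ?_))
    · refine congrArg (· + _) (Finset.sum_congr rfl fun l _ => ?_)
      rw [← e₃ l]
      rfl
    · rw [← e₂]
      rfl
  have g₁ := Finset.sum_congr (rfl : Λ = Λ) fun l _ =>
    finrank_agreeOn (a := a) (b := b) (S := {v | l ∈ D v}) (E := {i | l ∈ N i})
      fun i hi => ⟨ha i hi, hb i hi⟩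
  have g₂ := Finset.sum_congr (rfl : Λ = Λ) fun l _ =>
    finrank_agreeOn (a := a) (b := b) (S := {v | l ∈ (D v).inner}) (E := {i | l ∈ (N i).inner})
      fun i hi => ⟨Finset.inner_mono (ha i) hi, Finset.inner_mono (hb i) hi⟩
  rw [Finset.sum_add_distrib, Finset.sum_add_distrib, Finset.sum_ncard_setOf_mem Λ D hD] at g₁
  rw [Finset.sum_add_distrib, Finset.sum_add_distrib,
    Finset.sum_ncard_setOf_mem Λ (fun v => (D v).inner)
      fun v => (Finset.filter_subset _ _).trans (hD v)] at g₂
  have g₃ : ∑ v, (D v).card = ∑ v, (D v).inner.card + 2 * Fintype.card V := by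
    rw [← Finset.sum_congr rfl fun v _ => Finset.card_inner (hD₂ v), Finset.sum_add_distrib]
    simp [mul_comm]
  omega

/-- Two star rays are glued when a link carries both of them. -/
def RayLink {V ι L : Type*} (a b : ι → V) (D : V → Finset L) (N : ι → Finset L)
    (s t : {p : V × L // p.2 ∈ D p.1}) : Prop :=
  ∃ i, ∃ l ∈ N i, s.1 = (a i, l) ∧ t.1 = (b i, l)

/-- A family of functions, one for each letter, each respecting the links, is a single function on
the classes of rays. -/
theorem sum_finrank_agreeOn_le_card_quot {V ι L : Type*} [Fintype V] {a b : ι → V}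
    (Λ : Finset L) (D : V → Finset L) (N : ι → Finset L) (hD : ∀ v, D v ⊆ Λ) :
    ∑ l ∈ Λ, finrank ℚ (agreeOn a b {v | l ∈ D v} {i | l ∈ N i}) ≤
      Nat.card (Quot (RayLink a b D N)) := by
  classical
  have : Finite {p : V × L // p.2 ∈ D p.1} :=
    Finite.of_injective (β := V × Λ) (fun p => (p.1.1, ⟨p.1.2, hD _ p.2⟩)) fun p q h => by
      simp only [Prod.mk.injEq, Subtype.mk.injEq] at h
      exact Subtype.ext (Prod.ext h.1 h.2)
  have : Fintype (Quot (RayLink a b D N)) := Fintype.ofFinite _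
  let T : (∀ l : Λ, agreeOn a b {v | l.1 ∈ D v} {i | l.1 ∈ N i}) →ₗ[ℚ]
      (Quot (RayLink a b D N) → ℚ) :=
    { toFun := fun u => Quot.lift (fun s => (u ⟨s.1.2, hD _ s.2⟩).1 s.1.1) (by
        rintro ⟨⟨v, l⟩, hv⟩ ⟨⟨w, l'⟩, hw⟩ ⟨i, m, hm, h₁, h₂⟩
        simp only [Prod.mk.injEq] at h₁ h₂
        obtain ⟨rfl, rfl⟩ := h₁
        obtain ⟨rfl, rfl⟩ := h₂
        exact (u _).2.2 i hm)
      map_add' := fun u v => by ext q; induction q using Quot.ind; rfl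
      map_smul' := fun c u => by ext q; induction q using Quot.ind; rfl }
  have hT : Function.Injective T := by
    rw [← LinearMap.ker_eq_bot, LinearMap.ker_eq_bot']
    intro u hu
    ext l v
    by_cases hv : l.1 ∈ D v
    · exact congrFun hu (Quot.mk _ ⟨(v, l.1), hv⟩)
    · exact (u l).2.1 v hv
  have h := LinearMap.finrank_le_finrank_of_injective hT
  rw [Module.finrank_pi_fintype, Module.finrank_fintype_fun_eq_card, ← Nat.card_eq_fintype_card] at h
  rwa [← Finset.sum_coe_sort]

/-! ### The arithmetic inequality and its application to glued graphs -/

/-- The product of the sums exceeds the diagonal sum by the off-diagonal terms, and these are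
numerous when there are many classes. The classes are split into mixed ones `M`, those with only `a`
(`P`) and those with only `b` (`R`). -/
theorem sum_mul_add_le {Q : Type*} [Fintype Q] (a b : Q → ℤ) (ha : ∀ q, 0 ≤ a q)
    (hb : ∀ q, 0 ≤ b q) (hab : ∀ q, 1 ≤ a q + b q) (hle : ∑ q, a q ≤ ∑ q, b q) (j : ℤ)
    (hj : 2 * j ≤ Fintype.card Q) :
    ∑ q, a q * b q + (∑ q, a q) * j ≤ (∑ q, a q) * ∑ q, b q := by
  classical
  set M : Finset Q := Finset.univ.filter fun q => 1 ≤ a q ∧ 1 ≤ b q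
  set P : Finset Q := Finset.univ.filter fun q => b q = 0
  set R : Finset Q := Finset.univ.filter fun q => a q = 0
  have split : ∀ f : Q → ℤ, ∑ q, f q = ∑ q ∈ M, f q + ∑ q ∈ P, f q + ∑ q ∈ R, f q := fun f => by
    simp only [M, P, R, Finset.sum_filter]
    rw [← Finset.sum_add_distrib, ← Finset.sum_add_distrib]
    refine Finset.sum_congr rfl fun q _ => ?_
    have h₁ := ha q
    have h₂ := hb q
    have h₃ := hab q
    rcases h₁.eq_or_lt with h₄ | h₄ <;> rcases h₂.eq_or_lt with h₅ | h₅
    · omega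
    · simp [← h₄, h₅.ne']
    · simp [← h₅, h₄.ne']
    · simp [h₄.ne', h₅.ne']
      intro h
      omega
  have aR : ∑ q ∈ R, a q = 0 := Finset.sum_eq_zero fun q hq => (Finset.mem_filter.1 hq).2
  have bP : ∑ q ∈ P, b q = 0 := Finset.sum_eq_zero fun q hq => (Finset.mem_filter.1 hq).2
  have abP : ∑ q ∈ P, a q * b q = 0 :=
    Finset.sum_eq_zero fun q hq => by rw [(Finset.mem_filter.1 hq).2, mul_zero]
  have abR : ∑ q ∈ R, a q * b q = 0 :=
    Finset.sum_eq_zero fun q hq => by rw [(Finset.mem_filter.1 hq).2, zero_mul]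
  have lower : ∀ (S : Finset Q) (f : Q → ℤ), (∀ q ∈ S, 1 ≤ f q) → (S.card : ℤ) ≤ ∑ q ∈ S, f q :=
    fun S f hf => by simpa using Finset.sum_le_sum hf
  have hP := lower P a fun q hq => by
    have := hab q
    have := (Finset.mem_filter.1 hq).2
    omega
  have hR := lower R b fun q hq => by
    have := hab q
    have := (Finset.mem_filter.1 hq).2
    omega
  have hMa := lower M a fun q hq => (Finset.mem_filter.1 hq).2.1
  have hMb := lower M b fun q hq => (Finset.mem_filter.1 hq).2.2
  -- Each `f q` is multiplied by the `g r` with `r ≠ q`, whose sum is at least `M.card - 1`.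
  have cross : ∀ f g : Q → ℤ, (∀ q ∈ M, 1 ≤ f q) → (∀ q ∈ M, 1 ≤ g q) →
      ∑ q ∈ M, f q * g q + (∑ q ∈ M, f q) * (M.card - 1) ≤
        (∑ q ∈ M, f q) * ∑ q ∈ M, g q := fun f g hf hg => by
    rw [Finset.sum_mul, Finset.sum_mul, ← Finset.sum_add_distrib]
    refine Finset.sum_le_sum fun q hq => ?_
    have h₁ := lower (M.erase q) g fun r hr => hg r (Finset.mem_of_mem_erase hr)
    have h₂ := Finset.add_sum_erase M g hq
    have h₃ := Finset.card_erase_add_one hq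
    have h₄ := hf q hq
    have h₅ : (M.card : ℤ) - 1 ≤ ∑ r ∈ M.erase q, g r := by omega
    rw [← h₂]
    nlinarith
  have c₁ := cross a b (fun q hq => (Finset.mem_filter.1 hq).2.1)
    fun q hq => (Finset.mem_filter.1 hq).2.2
  have c₂ := cross b a (fun q hq => (Finset.mem_filter.1 hq).2.2)
    fun q hq => (Finset.mem_filter.1 hq).2.1
  rw [Finset.sum_congr rfl fun q _ => mul_comm (b q) (a q)] at c₂
  have hcard := split fun _ => 1
  simp only [Finset.sum_const, nsmul_eq_mul, mul_one, Finset.card_univ] at hcard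
  have hM0 : M.card = 0 → ∑ q ∈ M, a q * b q = 0 ∧ ∑ q ∈ M, a q = 0 ∧ ∑ q ∈ M, b q = 0 :=
    fun h => by rw [Finset.card_eq_zero.1 h]; simp
  have hP0 : P.card = 0 → ∑ q ∈ P, a q = 0 := fun h => by rw [Finset.card_eq_zero.1 h]; simp
  have hR0 : R.card = 0 → ∑ q ∈ R, b q = 0 := fun h => by rw [Finset.card_eq_zero.1 h]; simp
  rw [split a, split b] at hle ⊢
  rw [split fun q => a q * b q]
  rw [aR, bP] at hle ⊢
  rw [abP, abR]
  generalize ∑ q ∈ M, a q * b q = s at *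
  generalize ∑ q ∈ M, a q = x at *
  generalize ∑ q ∈ M, b q = y at *
  generalize ∑ q ∈ P, a q = p' at *
  generalize ∑ q ∈ R, b q = r' at *
  generalize M.card = n at *
  generalize P.card = p at *
  generalize R.card = r at *
  simp only [add_zero] at *
  rw [hcard] at hj
  have p0 : (0 : ℤ) ≤ p' := by omega
  have r0 : (0 : ℤ) ≤ r' := by omega
  have x0 : (0 : ℤ) ≤ x := by omega
  have y0 : (0 : ℤ) ≤ y := by omega
  have hj' : (x + p') * (2 * j) ≤ (x + p') * (n + p' + r') :=
    mul_le_mul_of_nonneg_left (by omega) (by omega)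
  have k₁ : 0 ≤ p' * (y + r' - p' - x) := mul_nonneg p0 (by omega)
  have k₂ : 0 ≤ p' * (y - n) := mul_nonneg p0 (by omega)
  rcases Nat.eq_zero_or_pos n with hn | hn
  · obtain ⟨rfl, rfl, rfl⟩ := hM0 hn
    subst hn
    simp only [Nat.cast_zero] at *
    nlinarith
  -- Doubling the goal and using `c₁`, `c₂`, `hj'`, `k₁` reduces it to `x ≤ y * (n - 1) + x * r' +
  -- p' * (y - n)`. This is clear if `r' ≥ 1`, and follows from `x ≤ y` if `r' = 0` and `n ≥ 2`; `n
  -- = 1` needs care.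
  by_cases hr : r = 0
  · have hr' := hR0 hr
    subst hr hr'
    rcases Nat.lt_or_ge 1 n with hn₂ | hn₂
    · have : y ≤ y * (n - 1) := le_mul_of_one_le_right y0 (by omega)
      nlinarith
    · obtain rfl : n = 1 := by omega
      simp only [Nat.cast_one, Nat.cast_zero] at *
      by_cases hp : p = 0
      · have hp' := hP0 hp
        subst hp hp'
        -- There is a single class here, so `2 * j ≤ 1`, and integrality is essential.
        have : j ≤ 0 := by simp at hj; omega
        have := mul_nonneg x0 (neg_nonneg.2 this)
        nlinarith
      · have : (1 : ℤ) ≤ p' := by omega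
        have : 0 ≤ (p' - 1) * (y - 1) := mul_nonneg (by omega) (by omega)
        nlinarith
  · have h₁ : (1 : ℤ) ≤ r' := by omega
    have h₂ : 0 ≤ x * (r' - 1) := mul_nonneg x0 (by omega)
    have h₃ : 0 ≤ y * ((n : ℤ) - 1) := mul_nonneg y0 (by omega)
    nlinarith

/-- A related pair lies over one class, so `R` has at most the sum of the products of the fibre
sizes. -/
theorem ncard_add_mul_le {A B Q : Type*} [Fintype A] [Fintype B] [Fintype Q] (α : A → Q)
    (β : B → Q) (hsurj : ∀ q, (∃ x, α x = q) ∨ ∃ y, β y = q) (R : Finset (A × B))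
    (hR : ∀ p ∈ R, α p.1 = β p.2) (hle : Fintype.card A ≤ Fintype.card B) (j : ℤ)
    (hj : 2 * j ≤ Fintype.card Q) :
    (R.card : ℤ) + Fintype.card A * j ≤ Fintype.card A * Fintype.card B := by
  classical
  let fa : Q → Finset A := fun q => Finset.univ.filter fun x => α x = q
  let fb : Q → Finset B := fun q => Finset.univ.filter fun y => β y = q
  have hA : Fintype.card A = ∑ q, (fa q).card :=
    Finset.card_eq_sum_card_fiberwise (f := α) (t := Finset.univ) fun _ _ => by simp
  have hB : Fintype.card B = ∑ q, (fb q).card :=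
    Finset.card_eq_sum_card_fiberwise (f := β) (t := Finset.univ) fun _ _ => by simp
  have hRle : R.card ≤ ∑ q, (fa q).card * (fb q).card := by
    rw [Finset.card_eq_sum_card_fiberwise (f := fun p : A × B => α p.1) (t := Finset.univ)
      fun _ _ => by simp]
    refine Finset.sum_le_sum fun q _ => ?_
    rw [← Finset.card_product]
    refine Finset.card_le_card fun p hp => ?_
    obtain ⟨h₁, h₂⟩ := Finset.mem_filter.1 hp
    simp only [fa, fb, Finset.mem_product, Finset.mem_filter, Finset.mem_univ, true_and]
    exact ⟨h₂, (hR p h₁).symm.trans h₂⟩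
  have h := sum_mul_add_le (fun q => ((fa q).card : ℤ)) (fun q => ((fb q).card : ℤ))
    (fun q => by positivity) (fun q => by positivity) (fun q => by
      rcases hsurj q with ⟨x, hx⟩ | ⟨y, hy⟩
      · have : 0 < (fa q).card := Finset.card_pos.2 ⟨x, by simp [fa, hx]⟩
        omega
      · have : 0 < (fb q).card := Finset.card_pos.2 ⟨y, by simp [fb, hy]⟩
        omega) (by rw [hA, hB] at hle; exact_mod_cast hle) j hj
  rw [hA, hB]
  push_cast
  have : (R.card : ℤ) ≤ ∑ q, ((fa q).card : ℤ) * (fb q).card := by exact_mod_cast hRle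
  linarith

theorem card_sigma_inner {W L : Type*} [LinearOrder L] [Fintype W] (G : W → Finset L)
    (hG : ∀ w, 2 ≤ (G w).card) :
    (Fintype.card (Σ w, {l // l ∈ (G w).inner}) : ℤ) = ∑ w, ((G w).card - 2 : ℤ) := by
  rw [Fintype.card_sigma]
  push_cast
  refine Finset.sum_congr rfl fun w _ => ?_
  rw [Fintype.card_coe, ← Finset.card_inner (hG w)]
  push_cast
  ring

/-- The counting inequality for a pair of graphs glued along a correspondence of their vertices:
`j` is at most minus the Euler characteristic of the glued graph. -/
theorem sum_card_sub_two_add_mul_le {VH VK ι L : Type*} [Fintype VH] [Fintype VK] [Fintype ι]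
    [LinearOrder L] (a : ι → VH) (b : ι → VK) (hinj : ∀ i i', a i = a i' → b i = b i' → i = i')
    (Λ : Finset L) (DH : VH → Finset L) (DK : VK → Finset L) (N : ι → Finset L)
    (hH : ∀ v, DH v ⊆ Λ) (hK : ∀ v, DK v ⊆ Λ) (hH₂ : ∀ v, 2 ≤ (DH v).card)
    (hK₂ : ∀ v, 2 ≤ (DK v).card) (hN₂ : ∀ i, 2 ≤ (N i).card)
    (ha : ∀ i, N i ⊆ DH (a i)) (hb : ∀ i, N i ⊆ DK (b i))
    (hle : ∑ v, ((DH v).card - 2 : ℤ) ≤ ∑ v, ((DK v).card - 2 : ℤ)) (j : ℤ)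
    (hj : 2 * j + 2 * finrank ℚ (agree (Sum.inl ∘ a) (Sum.inr ∘ b : ι → VH ⊕ VK) Set.univ) ≤
      ∑ l ∈ Λ, finrank ℚ (agreeOn (Sum.inl ∘ a) (Sum.inr ∘ b : ι → VH ⊕ VK)
        {v | l ∈ Sum.elim DH DK v} {i | l ∈ N i})) :
    ∑ i, ((N i).card - 2 : ℤ) + (∑ v, ((DH v).card - 2 : ℤ)) * j ≤
      (∑ v, ((DH v).card - 2 : ℤ)) * ∑ v, ((DK v).card - 2 : ℤ) := by
  classical
  let D : VH ⊕ VK → Finset L := Sum.elim DH DK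
  have hD : ∀ v, D v ⊆ Λ := by rintro (v | v) <;> simp [D, hH, hK]
  have hD₂ : ∀ v, 2 ≤ (D v).card := by rintro (v | v) <;> simp [D, hH₂, hK₂]
  have h₁ := sum_finrank_agreeOn_le (a := Sum.inl ∘ a) (b := (Sum.inr ∘ b : ι → VH ⊕ VK))
    Λ D N hD hD₂ hN₂ ha hb
  have h₂ := sum_finrank_agreeOn_le_card_quot (a := Sum.inl ∘ a)
    (b := (Sum.inr ∘ b : ι → VH ⊕ VK)) Λ (fun v => (D v).inner) (fun i => (N i).inner)
    (fun v => (Finset.filter_subset _ _).trans (hD v))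
  let r := RayLink (Sum.inl ∘ a) (Sum.inr ∘ b : ι → VH ⊕ VK) (fun v => (D v).inner)
    fun i => (N i).inner
  let A := Σ v, {l // l ∈ (DH v).inner}
  let B := Σ v, {l // l ∈ (DK v).inner}
  let α : A → Quot r := fun x => Quot.mk r ⟨(Sum.inl x.1, x.2.1), x.2.2⟩
  let β : B → Quot r := fun y => Quot.mk r ⟨(Sum.inr y.1, y.2.1), y.2.2⟩
  have hsurj : ∀ q, (∃ x, α x = q) ∨ ∃ y, β y = q := fun q => by
    induction q using Quot.ind with
    | mk s =>
      obtain ⟨⟨v | v, l⟩, hl⟩ := s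
      · exact Or.inl ⟨⟨v, l, hl⟩, rfl⟩
      · exact Or.inr ⟨⟨v, l, hl⟩, rfl⟩
  have : Finite (Quot r) := by
    refine Finite.of_surjective (Sum.elim α β) fun q => ?_
    rcases hsurj q with ⟨x, hx⟩ | ⟨y, hy⟩
    · exact ⟨Sum.inl x, hx⟩
    · exact ⟨Sum.inr y, hy⟩
  have : Fintype (Quot r) := Fintype.ofFinite _
  let e : (Σ i, {l // l ∈ (N i).inner}) ↪ A × B :=
    ⟨fun s => (⟨a s.1, s.2.1, Finset.inner_mono (ha _) s.2.2⟩,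
      ⟨b s.1, s.2.1, Finset.inner_mono (hb _) s.2.2⟩), by
      rintro ⟨i, l, hl⟩ ⟨i', l', hl'⟩ h
      obtain rfl := hinj i i' (congrArg (fun p => p.1.1) h) (congrArg (fun p => p.2.1) h)
      obtain rfl : l = l' := congrArg (fun p => p.1.2.1) h
      rfl⟩
  have cA := card_sigma_inner DH hH₂
  have cB := card_sigma_inner DK hK₂
  have cN := card_sigma_inner N hN₂
  have key := ncard_add_mul_le α β hsurj (Finset.univ.map e) (fun p hp => by
    obtain ⟨⟨i, l, hl⟩, -, rfl⟩ := Finset.mem_map.1 hp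
    exact Quot.sound ⟨i, l, hl, rfl, rfl⟩) (by rw [← cA, ← cB] at hle; exact_mod_cast hle) j (by
      rw [← Nat.card_eq_fintype_card]
      -- Twice the number of glued vertices cancels between `hj` and the star estimate, leaving `2 *
      -- j` at most the number of classes of inner rays.
      have h₃ := hj.trans (Nat.cast_le.2 (h₁.trans (Nat.add_le_add_right h₂ _)))
      rw [Nat.cast_add, Nat.cast_mul] at h₃
      exact le_of_add_le_add_right h₃)
  rw [Finset.card_map, Finset.card_univ, cA, cB, cN] at key
  exact key

/-! ### Rank of a free group as a dimension of characters -/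

/-- The rational additive characters of a group. -/
def ratChars (A : Type*) [Group A] : Submodule ℚ (A → ℚ) where
  carrier := {χ | ∀ s t, χ (s * t) = χ s + χ t}
  add_mem' := fun hu hv s t => by simp only [Pi.add_apply, hu s t, hv s t]; ring
  zero_mem' := fun _ _ => by simp
  smul_mem' := fun c u hu s t => by simp [hu s t, mul_add]

section RatChars

variable {A : Type*} [Group A]

theorem ratChars_mul (χ : ratChars A) (s t : A) : χ.1 (s * t) = χ.1 s + χ.1 t := χ.2 s t

theorem ratChars_one (χ : ratChars A) : χ.1 1 = 0 := by
  simpa using ratChars_mul χ 1 1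

theorem ratChars_inv (χ : ratChars A) (s : A) : χ.1 s⁻¹ = -χ.1 s := by
  have := ratChars_mul χ s⁻¹ s
  rw [inv_mul_cancel, ratChars_one] at this
  linarith

theorem ratChars_eq_zero_of_closure (χ : ratChars A) {S : Set A} (hS : Subgroup.closure S = ⊤)
    (h : ∀ s ∈ S, χ.1 s = 0) (x : A) : χ.1 x = 0 := by
  have hx : x ∈ Subgroup.closure S := hS ▸ Subgroup.mem_top x
  induction hx using Subgroup.closure_induction with
  | mem x hx => exact h x hx
  | one => exact ratChars_one χ
  | mul x y _ _ hx hy => rw [ratChars_mul, hx, hy, add_zero]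
  | inv x _ hx => rw [ratChars_inv, hx, neg_zero]

/-- Restriction of characters to a set of group elements. -/
def ratCharsRestrict (S : Set A) : ratChars A →ₗ[ℚ] (S → ℚ) where
  toFun χ s := χ.1 s
  map_add' _ _ := rfl
  map_smul' _ _ := rfl

theorem ratCharsRestrict_injective {S : Set A} (hS : Subgroup.closure S = ⊤) :
    Function.Injective (ratCharsRestrict S) := by
  rw [← LinearMap.ker_eq_bot, LinearMap.ker_eq_bot']
  intro χ hχ
  ext x
  exact ratChars_eq_zero_of_closure χ hS (fun s hs => congrFun hχ ⟨s, hs⟩) x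

theorem finiteDimensional_ratChars [Group.FG A] : FiniteDimensional ℚ (ratChars A) := by
  obtain ⟨S, -, hS⟩ := Group.rank_spec A
  exact FiniteDimensional.of_injective _ (ratCharsRestrict_injective hS)

theorem finrank_ratChars_le_rank [Group.FG A] : finrank ℚ (ratChars A) ≤ Group.rank A := by
  obtain ⟨S, hcard, hS⟩ := Group.rank_spec A
  have := LinearMap.finrank_le_finrank_of_injective (ratCharsRestrict_injective hS)
  rw [Module.finrank_fintype_fun_eq_card] at this
  simpa [hcard] using this

/-- Characters of a free group have arbitrary values on the generators. -/
noncomputable def extendGenerators [IsFreeGroup A] :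
    (IsFreeGroup.Generators A → ℚ) →ₗ[ℚ] ratChars A where
  toFun f := ⟨fun x => (IsFreeGroup.lift (fun g => Multiplicative.ofAdd (f g)) x).toAdd,
    fun s t => by simp⟩
  map_add' f g := by
    have : (IsFreeGroup.lift fun x => Multiplicative.ofAdd ((f + g) x)) =
        (IsFreeGroup.lift (G := A) fun x => Multiplicative.ofAdd (f x)) *
          IsFreeGroup.lift fun x => Multiplicative.ofAdd (g x) :=
      IsFreeGroup.ext_hom fun a => by simp
    ext x
    exact congrArg Multiplicative.toAdd (DFunLike.congr_fun this x)
  map_smul' c f := by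
    have : (IsFreeGroup.lift fun x => Multiplicative.ofAdd ((c • f) x)) =
        (AddMonoidHom.toMultiplicative (AddMonoidHom.mulLeft c)).comp
          (IsFreeGroup.lift (G := A) fun x => Multiplicative.ofAdd (f x)) :=
      IsFreeGroup.ext_hom fun a => by simp
    ext x
    exact congrArg Multiplicative.toAdd (DFunLike.congr_fun this x)

theorem extendGenerators_of [IsFreeGroup A] (f : IsFreeGroup.Generators A → ℚ)
    (g : IsFreeGroup.Generators A) : (extendGenerators f).1 (IsFreeGroup.of g) = f g := by
  simp [extendGenerators]

theorem extendGenerators_injective [IsFreeGroup A] :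
    Function.Injective (extendGenerators (A := A)) := fun f g h => by
  ext x
  rw [← extendGenerators_of f, h, extendGenerators_of]

theorem closure_range_of [IsFreeGroup A] :
    Subgroup.closure (Set.range (IsFreeGroup.of (G := A))) = ⊤ := by
  have h : Set.range (IsFreeGroup.of (G := A)) =
      (IsFreeGroup.mulEquiv A).toMonoidHom '' Set.range FreeGroup.of := by
    rw [← Set.range_comp]
    congr 1
  rw [h, ← MonoidHom.map_closure, FreeGroup.closure_range_of, ← MonoidHom.range_eq_map]
  exact MonoidHom.range_eq_top.2 (IsFreeGroup.mulEquiv A).surjective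

/-- A free group with finite-dimensional space of characters is finitely generated, and its rank is
at most this dimension. -/
theorem exists_generators_of_finiteDimensional [IsFreeGroup A]
    [FiniteDimensional ℚ (ratChars A)] :
    ∃ S : Finset A, S.card ≤ finrank ℚ (ratChars A) ∧ Subgroup.closure (S : Set A) = ⊤ := by
  classical
  have h₁ : FiniteDimensional ℚ (IsFreeGroup.Generators A → ℚ) :=
    FiniteDimensional.of_injective _ extendGenerators_injective
  have h₂ : Finite (IsFreeGroup.Generators A) :=
    (Pi.linearIndependent_single_one (IsFreeGroup.Generators A) ℚ).finite
  have := Fintype.ofFinite (IsFreeGroup.Generators A)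
  have h₃ := LinearMap.finrank_le_finrank_of_injective (extendGenerators_injective (A := A))
  rw [Module.finrank_fintype_fun_eq_card] at h₃
  exact ⟨Finset.univ.image IsFreeGroup.of, Finset.card_image_le.trans h₃,
    by simpa using closure_range_of (A := A)⟩

theorem fg_of_finiteDimensional_ratChars [IsFreeGroup A] [FiniteDimensional ℚ (ratChars A)] :
    Group.FG A := by
  obtain ⟨S, -, hS⟩ := exists_generators_of_finiteDimensional (A := A)
  exact ⟨⟨S, hS⟩⟩

/-- A character is determined on any generating set, which bounds the dimension by the rank;
prescribing its values freely on a basis gives the other bound. -/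
theorem rank_eq_finrank_ratChars [IsFreeGroup A] [Group.FG A] :
    Group.rank A = finrank ℚ (ratChars A) := by
  have := finiteDimensional_ratChars (A := A)
  obtain ⟨S, hcard, hS⟩ := exists_generators_of_finiteDimensional (A := A)
  exact le_antisymm ((Group.rank_le hS).trans hcard) finrank_ratChars_le_rank

end RatChars

/-! ### Integration of edge functions along paths in a Schreier graph -/

section Cocycle

variable {X Ω : Type*} [MulAction (FreeGroup X) Ω]

/-- The skew product permutation action determined by a function on edges. -/
def skewProduct (f : Ω → X → ℚ) : FreeGroup X →* Equiv.Perm (Ω × ℚ) :=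
  FreeGroup.lift fun x =>
    { toFun := fun p => (FreeGroup.of x • p.1, p.2 + f p.1 x)
      invFun := fun p => ((FreeGroup.of x)⁻¹ • p.1, p.2 - f ((FreeGroup.of x)⁻¹ • p.1) x)
      left_inv := fun p => by simp
      right_inv := fun p => by simp }

/-- The sum of `f` along the path from `c` spelled by `w`, read from the right. -/
def pathIntegral (f : Ω → X → ℚ) (w : FreeGroup X) (c : Ω) : ℚ := (skewProduct f w (c, 0)).2

theorem skewProduct_apply (f : Ω → X → ℚ) (w : FreeGroup X) (c : Ω) (t : ℚ) :
    skewProduct f w (c, t) = (w • c, t + pathIntegral f w c) := by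
  have key : ∀ w : FreeGroup X, ∀ c, ∃ s, ∀ t, skewProduct f w (c, t) = (w • c, t + s) := by
    intro w
    induction w using FreeGroup.induction_on with
    | C1 => exact fun c => ⟨0, fun t => by simp⟩
    | of x => exact fun c => ⟨f c x, fun t => by simp [skewProduct]⟩
    | inv_of x _ =>
      refine fun c => ⟨-f ((FreeGroup.of x)⁻¹ • c) x, fun t => ?_⟩
      rw [map_inv, Equiv.Perm.inv_eq_iff_eq]
      simp [skewProduct]
    | mul x y hx hy =>
      intro c
      obtain ⟨s, hs⟩ := hy c
      obtain ⟨s', hs'⟩ := hx (y • c)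
      exact ⟨s + s', fun t => by
        rw [map_mul, Equiv.Perm.mul_apply, hs, hs', mul_smul, add_assoc]⟩
  obtain ⟨s, hs⟩ := key w c
  rw [pathIntegral, hs, hs, zero_add]

theorem pathIntegral_mul (f : Ω → X → ℚ) (v w : FreeGroup X) (c : Ω) :
    pathIntegral f (v * w) c = pathIntegral f v (w • c) + pathIntegral f w c := by
  have h := skewProduct_apply f (v * w) c 0
  rw [map_mul, Equiv.Perm.mul_apply, skewProduct_apply, skewProduct_apply] at h
  have := congrArg Prod.snd h
  simp only [zero_add] at this
  rw [← this, add_comm]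

@[simp]
theorem pathIntegral_of (f : Ω → X → ℚ) (x : X) (c : Ω) :
    pathIntegral f (FreeGroup.of x) c = f c x := by
  simp [pathIntegral, skewProduct]

@[simp]
theorem pathIntegral_one (f : Ω → X → ℚ) (c : Ω) : pathIntegral f 1 c = 0 := by
  simp [pathIntegral]

theorem pathIntegral_of_inv (f : Ω → X → ℚ) (x : X) (c : Ω) :
    pathIntegral f (FreeGroup.of x)⁻¹ c = -f ((FreeGroup.of x)⁻¹ • c) x := by
  have h := pathIntegral_mul f (FreeGroup.of x) (FreeGroup.of x)⁻¹ c
  rw [mul_inv_cancel, pathIntegral_one, pathIntegral_of] at h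
  linarith

/-- A cocycle is determined by its values on the generators. -/
theorem eq_pathIntegral (f : Ω → X → ℚ) (J : FreeGroup X → Ω → ℚ)
    (hmul : ∀ v w c, J (v * w) c = J v (w • c) + J w c)
    (hof : ∀ x c, J (FreeGroup.of x) c = f c x) (w : FreeGroup X) (c : Ω) :
    J w c = pathIntegral f w c := by
  have h1 : ∀ c, J 1 c = 0 := fun c => by simpa using hmul 1 1 c
  induction w using FreeGroup.induction_on generalizing c with
  | C1 => rw [h1, pathIntegral_one]
  | of x => rw [hof, pathIntegral_of]
  | inv_of x _ =>
    have h := hmul (FreeGroup.of x) (FreeGroup.of x)⁻¹ c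
    rw [mul_inv_cancel, h1, hof] at h
    rw [pathIntegral_of_inv]
    linarith
  | mul x y hx hy => rw [hmul, hx, hy, pathIntegral_mul]

theorem pathIntegral_add (f g : Ω → X → ℚ) (w : FreeGroup X) (c : Ω) :
    pathIntegral (f + g) w c = pathIntegral f w c + pathIntegral g w c :=
  (eq_pathIntegral (f + g) (fun w c => pathIntegral f w c + pathIntegral g w c)
    (fun v w c => by simp only [pathIntegral_mul]; ring) (fun x c => by simp) w c).symm

theorem pathIntegral_smul (r : ℚ) (f : Ω → X → ℚ) (w : FreeGroup X) (c : Ω) :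
    pathIntegral (r • f) w c = r * pathIntegral f w c :=
  (eq_pathIntegral (r • f) (fun w c => r * pathIntegral f w c)
    (fun v w c => by simp only [pathIntegral_mul]; ring) (fun x c => by simp) w c).symm

theorem pathIntegral_coboundary (g : Ω → ℚ) (w : FreeGroup X) (c : Ω) :
    pathIntegral (fun c x => g (FreeGroup.of x • c) - g c) w c = g (w • c) - g c :=
  (eq_pathIntegral _ (fun w c => g (w • c) - g c)
    (fun v w c => by rw [mul_smul]; ring) (fun x c => rfl) w c).symm

theorem pathIntegral_comp {Ω' : Type*} [MulAction (FreeGroup X) Ω'] (π : Ω' → Ω)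
    (hπ : ∀ (w : FreeGroup X) c, π (w • c) = w • π c) (f : Ω → X → ℚ) (w : FreeGroup X) (c : Ω') :
    pathIntegral (fun c x => f (π c) x) w c = pathIntegral f w (π c) :=
  (eq_pathIntegral _ (fun w c => pathIntegral f w (π c))
    (fun v w c => by rw [pathIntegral_mul, hπ]) (fun x c => by simp) w c).symm

/-- The character of a point stabilizer given by integration along loops. -/
def loopIntegral (ω : Ω) :
    (Ω → X → ℚ) →ₗ[ℚ] ratChars (MulAction.stabilizer (FreeGroup X) ω) where
  toFun f := ⟨fun w => pathIntegral f w.1 ω, fun s t => by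
    have ht : (t : FreeGroup X) • ω = ω := t.2
    simp only [Subgroup.coe_mul, pathIntegral_mul, ht]⟩
  map_add' f g := by ext w; exact pathIntegral_add f g w.1 ω
  map_smul' r f := by ext w; exact pathIntegral_smul r f w.1 ω

theorem loopIntegral_apply (ω : Ω) (f : Ω → X → ℚ) (w : MulAction.stabilizer (FreeGroup X) ω) :
    (loopIntegral ω f).1 w = pathIntegral f w.1 ω := rfl

/-- Choose `s c` carrying `ω` to `c` for each `c` in the orbit. Then `χ ((s (w • c))⁻¹ * w * s c)`
is a cocycle, hence the integral of its values on generators; on loops at `ω` the two factors `s ω`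
cancel and `χ w` remains. Off the orbit the cocycle is set to zero. -/
theorem loopIntegral_surjective (ω : Ω) : Function.Surjective (loopIntegral (X := X) ω) := by
  classical
  intro χ
  have hs : ∀ c : Ω, ∃ s : FreeGroup X, c ∈ MulAction.orbit (FreeGroup X) ω → s • ω = c := fun c => by
    by_cases hc : c ∈ MulAction.orbit (FreeGroup X) ω
    · obtain ⟨s, hs⟩ := hc
      exact ⟨s, fun _ => hs⟩
    · exact ⟨1, fun h => absurd h hc⟩
  choose s hs using hs
  have hst : ∀ (w : FreeGroup X) (c : Ω), c ∈ MulAction.orbit (FreeGroup X) ω →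
      (s (w • c))⁻¹ * w * s c ∈ MulAction.stabilizer (FreeGroup X) ω := fun w c hc => by
    rw [MulAction.mem_stabilizer_iff, mul_smul, mul_smul, hs c hc, inv_smul_eq_iff,
      hs (w • c) (MulAction.mem_orbit_of_mem_orbit w hc)]
  let χ' : FreeGroup X → ℚ := fun g =>
    if h : g ∈ MulAction.stabilizer (FreeGroup X) ω then χ.1 ⟨g, h⟩ else 0
  have hχ' : ∀ g (h : g ∈ MulAction.stabilizer (FreeGroup X) ω), χ' g = χ.1 ⟨g, h⟩ :=
    fun g h => dif_pos h
  have hmul : ∀ g ∈ MulAction.stabilizer (FreeGroup X) ω,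
      ∀ h ∈ MulAction.stabilizer (FreeGroup X) ω, χ' (g * h) = χ' g + χ' h :=
    fun g hg h hh => by
      rw [hχ' _ (mul_mem hg hh), hχ' g hg, hχ' h hh, ← ratChars_mul]
      rfl
  let J : FreeGroup X → Ω → ℚ := fun w c =>
    if c ∈ MulAction.orbit (FreeGroup X) ω then χ' ((s (w • c))⁻¹ * w * s c) else 0
  refine ⟨fun c x => J (FreeGroup.of x) c, ?_⟩
  ext ⟨w, hw⟩
  rw [loopIntegral_apply, ← eq_pathIntegral _ J _ fun _ _ => rfl]
  · have hω : ω ∈ MulAction.orbit (FreeGroup X) ω := MulAction.mem_orbit_self ω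
    have hsω : s ω ∈ MulAction.stabilizer (FreeGroup X) ω := hs ω hω
    have hwω : w • ω = ω := hw
    simp only [J, if_pos hω, hwω]
    rw [hmul _ (mul_mem (inv_mem hsω) hw) _ hsω, hmul _ (inv_mem hsω) _ hw]
    have h₁ : χ' ((s ω)⁻¹ * s ω) = 0 := by
      rw [inv_mul_cancel, hχ' 1 (one_mem _)]
      exact ratChars_one χ
    rw [hmul _ (inv_mem hsω) _ hsω] at h₁
    rw [hχ' w hw] at *
    linarith
  · intro v w c
    by_cases hc : c ∈ MulAction.orbit (FreeGroup X) ω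
    · have hwc : w • c ∈ MulAction.orbit (FreeGroup X) ω := MulAction.mem_orbit_of_mem_orbit w hc
      simp only [J, if_pos hc, if_pos hwc]
      rw [← hmul _ (hst v _ hwc) _ (hst w c hc), mul_smul]
      congr 1
      group
    · have hwc : w • c ∉ MulAction.orbit (FreeGroup X) ω :=
        fun h => hc (by simpa using MulAction.mem_orbit_of_mem_orbit w⁻¹ h)
      simp only [J, if_neg hc, if_neg hwc, add_zero]

end Cocycle

/-! ### Darts on reduced loops, degrees and finiteness -/

section Darts

open FreeGroup (IsReduced invRev mk)

variable {X Ω : Type*} [MulAction (FreeGroup X) Ω]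

/-- The inverse of a letter. -/
def flipLetter (l : X × Bool) : X × Bool := (l.1, !l.2)

@[simp]
theorem flipLetter_flipLetter (l : X × Bool) : flipLetter (flipLetter l) = l := by
  simp [flipLetter]

theorem mk_flipLetter (l : X × Bool) : mk [flipLetter l] = (mk [l])⁻¹ := by
  simp [flipLetter, FreeGroup.inv_mk, invRev]

theorem mk_cons (l : X × Bool) (L : List (X × Bool)) : mk (l :: L) = mk [l] * mk L := by
  simp [FreeGroup.mul_mk]

theorem mk_append (L L' : List (X × Bool)) : mk (L ++ L') = mk L * mk L' :=
  FreeGroup.mul_mk.symm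

theorem invRev_append (L L' : List (X × Bool)) : invRev (L ++ L') = invRev L' ++ invRev L := by
  simp [invRev]

theorem invRev_cons (l : X × Bool) (L : List (X × Bool)) :
    invRev (l :: L) = invRev L ++ [flipLetter l] := by
  simp [invRev, flipLetter]

theorem isReduced_invRev {L : List (X × Bool)} (h : IsReduced L) : IsReduced (invRev L) := by
  classical
  rw [FreeGroup.isReduced_iff_reduce_eq] at h ⊢
  rw [FreeGroup.reduce_invRev, h]

theorem mk_pair_flip (x : X) (b : Bool) (L : List (X × Bool)) :
    mk ((x, b) :: (x, !b) :: L) = mk L := by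
  rw [mk_cons, mk_cons (x, !b), ← mul_assoc]
  have : mk [(x, !b)] = (mk [(x, b)])⁻¹ := mk_flipLetter (x, b)
  rw [this, mul_inv_cancel, one_mul]

/-- The dart `l` issuing from `c` lies on a reduced loop at `ω`. -/
def IsDart (ω c : Ω) (l : X × Bool) : Prop :=
  ∃ L₁ L₂, IsReduced (L₁ ++ l :: L₂) ∧ mk (L₁ ++ l :: L₂) • ω = ω ∧ mk L₂ • ω = c

theorem IsDart.flip {ω c : Ω} {l : X × Bool} (h : IsDart ω c l) :
    IsDart ω (mk [l] • c) (flipLetter l) := by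
  obtain ⟨L₁, L₂, hr, hl, rfl⟩ := h
  have e : invRev (L₁ ++ l :: L₂) = invRev L₂ ++ flipLetter l :: invRev L₁ := by
    rw [invRev_append, invRev_cons, List.append_assoc, List.singleton_append]
  refine ⟨invRev L₂, invRev L₁, e ▸ isReduced_invRev hr, ?_, ?_⟩
  · rw [← e, ← FreeGroup.inv_mk, inv_smul_eq_iff, hl]
  · rw [← FreeGroup.inv_mk, inv_smul_eq_iff, ← mul_smul (mk [l]), ← mk_cons, ← mul_smul,
      ← mk_append, hl]

/-- Induction along reduced loops. -/
theorem suffix_induction {ω : Ω} {P : List (X × Bool) → Prop} (nil : P [])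
    (cons : ∀ l L, IsDart ω (mk L • ω) l → P L → P (l :: L)) (L₁ L₂ : List (X × Bool))
    (hr : IsReduced (L₁ ++ L₂)) (hl : mk (L₁ ++ L₂) • ω = ω) : P L₂ := by
  induction L₂ generalizing L₁ with
  | nil => exact nil
  | cons l L ih =>
    refine cons l L ⟨L₁, L, hr, hl, rfl⟩ (ih (L₁ ++ [l]) ?_ ?_)
    · simpa using hr
    · simpa using hl

theorem pathIntegral_letter_congr {ω : Ω} {f f' : Ω → X → ℚ}
    (h : ∀ c x, IsDart ω c (x, true) → f c x = f' c x) {c : Ω} {l : X × Bool}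
    (hd : IsDart ω c l) : pathIntegral f (mk [l]) c = pathIntegral f' (mk [l]) c := by
  obtain ⟨x, b⟩ := l
  cases b
  · have e : mk [(x, false)] = (FreeGroup.of x)⁻¹ := mk_flipLetter (x, true)
    rw [e, pathIntegral_of_inv, pathIntegral_of_inv, h]
    simpa [e, flipLetter] using hd.flip
  · exact (pathIntegral_of f x c).trans ((h c x hd).trans (pathIntegral_of f' x c).symm)

/-- Integrals along prefixes of reduced loops only depend on the values on darts. -/
theorem pathIntegral_suffix_congr {ω : Ω} {f f' : Ω → X → ℚ}
    (h : ∀ c x, IsDart ω c (x, true) → f c x = f' c x) (L₁ L₂ : List (X × Bool))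
    (hr : IsReduced (L₁ ++ L₂)) (hl : mk (L₁ ++ L₂) • ω = ω) :
    pathIntegral f (mk L₂) ω = pathIntegral f' (mk L₂) ω := by
  refine suffix_induction (P := fun L => pathIntegral f (mk L) ω = pathIntegral f' (mk L) ω)
    ?_ (fun l L hd ih => ?_) L₁ L₂ hr hl
  · rw [← FreeGroup.one_eq_mk, pathIntegral_one, pathIntegral_one]
  · rw [mk_cons, pathIntegral_mul, pathIntegral_mul, ih, pathIntegral_letter_congr h hd]

/-- A stabilizer element is represented by its reduced word, whose loop uses only darts. -/
theorem loopIntegral_congr {ω : Ω} {f f' : Ω → X → ℚ}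
    (h : ∀ c x, IsDart ω c (x, true) → f c x = f' c x) : loopIntegral ω f = loopIntegral ω f' := by
  classical
  ext ⟨w, hw⟩
  have hw' : mk w.toWord • ω = ω := by rw [FreeGroup.mk_toWord]; exact hw
  have := pathIntegral_suffix_congr h [] w.toWord FreeGroup.isReduced_toWord hw'
  rwa [FreeGroup.mk_toWord] at this

/-- The vertices on reduced loops. -/
def loopVertices (ω : Ω) : Set Ω := {c | ∃ l : X × Bool, IsDart ω c l}

theorem IsDart.smul_mem {ω c : Ω} {l : X × Bool} (h : IsDart ω c l) :
    mk [l] • c ∈ loopVertices (X := X) ω := ⟨_, h.flip⟩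

theorem IsDart.of_smul_mem {ω c : Ω} {x : X} (h : IsDart ω c (x, true)) :
    FreeGroup.of x • c ∈ loopVertices (X := X) ω := h.smul_mem

theorem mem_orbit_of_mem_loopVertices {ω c : Ω} (h : c ∈ loopVertices (X := X) ω) :
    c ∈ MulAction.orbit (FreeGroup X) ω := by
  obtain ⟨l, L₁, L₂, -, -, rfl⟩ := h
  exact MulAction.mem_orbit _ _

theorem base_mem_loopVertices {ω : Ω} (h : MulAction.stabilizer (FreeGroup X) ω ≠ ⊥) :
    ω ∈ loopVertices (X := X) ω := by
  classical
  obtain ⟨w, hw, hw1⟩ := (Subgroup.bot_or_exists_ne_one _).resolve_left h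
  have hne : w.toWord ≠ [] := fun h => hw1 (FreeGroup.toWord_eq_nil_iff.1 h)
  obtain ⟨L, l, hL⟩ := List.eq_nil_or_concat w.toWord |>.resolve_left hne
  refine ⟨l, L, [], ?_, ?_, ?_⟩
  · rw [← List.concat_eq_append, ← hL]; exact FreeGroup.isReduced_toWord
  · rw [← List.concat_eq_append, ← hL, FreeGroup.mk_toWord]; exact hw
  · rw [← FreeGroup.one_eq_mk, one_smul]

/-- A function without increments along darts takes its value at the base point on every vertex. -/
theorem eq_base_of_increments_eq_zero {ω : Ω} {g : Ω → ℚ}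
    (h : ∀ c (x : X), IsDart ω c (x, true) → g (FreeGroup.of x • c) - g c = 0) {c : Ω}
    (hc : c ∈ loopVertices (X := X) ω) : g c = g ω := by
  obtain ⟨l, L₁, L₂, hr, hl, rfl⟩ := hc
  have := pathIntegral_suffix_congr (f := fun c x => g (FreeGroup.of x • c) - g c) (f' := 0) h
    (L₁ ++ [l]) L₂ (by simpa using hr) (by simpa using hl)
  rw [pathIntegral_coboundary] at this
  -- Homogeneity with scalar zero evaluates the integral of the zero function.
  have h0 := pathIntegral_smul (0 : ℚ) (0 : Ω → X → ℚ) (mk L₂) ω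
  rw [zero_smul, zero_mul] at h0
  linarith

/-- A function on edges with vanishing loop integrals is a coboundary. -/
theorem exists_potential {ω : Ω} {f : Ω → X → ℚ} (h : loopIntegral ω f = 0) :
    ∃ g : Ω → ℚ, ∀ c ∈ MulAction.orbit (FreeGroup X) ω, ∀ x,
      f c x = g (FreeGroup.of x • c) - g c := by
  classical
  have hwd : ∀ v w : FreeGroup X, v • ω = w • ω → pathIntegral f v ω = pathIntegral f w ω := by
    intro v w hvw
    have hm : w⁻¹ * v ∈ MulAction.stabilizer (FreeGroup X) ω := by
      rw [MulAction.mem_stabilizer_iff, mul_smul, inv_smul_eq_iff, hvw]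
    have h0 : pathIntegral f (w⁻¹ * v) ω = 0 := congrFun (congrArg Subtype.val h) ⟨_, hm⟩
    have h1 := pathIntegral_mul f w (w⁻¹ * v) ω
    rw [mul_inv_cancel_left, h0, (MulAction.mem_stabilizer_iff.1 hm), add_zero] at h1
    exact h1
  refine ⟨fun c => if h : ∃ w : FreeGroup X, w • ω = c then pathIntegral f h.choose ω else 0, ?_⟩
  rintro _ ⟨w, rfl⟩ x
  have e₁ : ∃ w' : FreeGroup X, w' • ω = w • ω := ⟨w, rfl⟩
  have e₂ : ∃ w' : FreeGroup X, w' • ω = FreeGroup.of x • w • ω :=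
    ⟨FreeGroup.of x * w, mul_smul _ _ _⟩
  simp only [dif_pos e₁, dif_pos e₂]
  rw [hwd _ _ e₁.choose_spec, hwd _ (FreeGroup.of x * w) (e₂.choose_spec.trans (mul_smul _ _ _).symm),
    pathIntegral_mul, pathIntegral_of]
  ring

/-- If a stabilizer contains a nontrivial cyclically reduced element, every vertex on a reduced
loop has degree at least two. -/
theorem exists_ne_isDart {ω : Ω} {L : List (X × Bool)} (hL : L ≠ [])
    (hc : FreeGroup.IsCyclicallyReduced L) (hω : mk L • ω = ω) {c : Ω} {l : X × Bool}
    (h : IsDart ω c l) : ∃ l', l' ≠ l ∧ IsDart ω c l' := by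
  obtain ⟨L₁, L₂, hr, hl, rfl⟩ := h
  cases L₂ with
  | cons l₂ L₂ =>
    -- Turn back along the dart by which the loop arrived; reducedness prevents `l` from being that
    -- one.
    refine ⟨flipLetter l₂, ?_, ?_⟩
    · rintro rfl
      have := hr.infix (L₁ := [flipLetter l₂, l₂]) ⟨L₁, L₂, by simp⟩
      simp [flipLetter] at this
    · rw [mk_cons, mul_smul]
      exact IsDart.flip ⟨L₁ ++ [l], L₂, by simpa using hr, by simpa using hl, rfl⟩
  | nil =>
    rw [← FreeGroup.one_eq_mk, one_smul]
    -- Words act from the right, so at the base point the last letter `a` departs and the first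
    -- letter `b` arrives. Both `a` and `flipLetter b` are darts there, distinct by cyclic
    -- reducedness, so one of them differs from `l`.
    obtain ⟨L', a, rfl⟩ := List.eq_nil_or_concat' L |>.resolve_left hL
    have ha : IsDart ω ω a := ⟨L', [], hc.isReduced, hω, by rw [← FreeGroup.one_eq_mk, one_smul]⟩
    obtain ⟨b, M, hM⟩ := List.exists_cons_of_ne_nil hL
    have hb : IsDart ω ω (flipLetter b) := by
      have : IsDart ω (mk M • ω) b :=
        ⟨[], M, by simpa [← hM] using hc.isReduced, by simpa [← hM] using hω, rfl⟩
      have := this.flip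
      rwa [← mul_smul, ← mk_cons, ← hM, hω] at this
    have hab : a ≠ flipLetter b := by
      rintro rfl
      have := hc.2 (flipLetter b) (by simp) b (by rw [hM]; rfl) rfl
      simp [flipLetter] at this
    by_cases hal : a = l
    · exact ⟨flipLetter b, fun h => hab (hal.trans h.symm), hb⟩
    · exact ⟨a, hal, ha⟩

/-- The path spelled by `L` from `ω` uses only darts in `S`. -/
def PathIn (S : Set (Ω × (X × Bool))) (ω : Ω) : List (X × Bool) → Prop
  | [] => True
  | l :: L => (mk L • ω, l) ∈ S ∧ PathIn S ω L

theorem pathIn_append {S : Set (Ω × (X × Bool))} {ω : Ω} (L L' : List (X × Bool)) :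
    PathIn S ω (L ++ L') ↔ PathIn S (mk L' • ω) L ∧ PathIn S ω L' := by
  induction L with
  | nil => simp [PathIn]
  | cons l L ih => rw [List.cons_append, PathIn, PathIn, ih, mk_append, mul_smul, and_assoc]

theorem PathIn.mono {S T : Set (Ω × (X × Bool))} (hST : S ⊆ T) {ω : Ω} {L : List (X × Bool)}
    (h : PathIn S ω L) : PathIn T ω L := by
  induction L with
  | nil => trivial
  | cons l L ih => exact ⟨hST h.1, ih h.2⟩

/-- A cancelling pair goes along a dart and back, so deleting it does not move the starting point of
the rest of the path. -/
theorem PathIn.red {S : Set (Ω × (X × Bool))} {ω : Ω} {L L' : List (X × Bool)}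
    (hred : FreeGroup.Red L L') (h : PathIn S ω L) : PathIn S ω L' := by
  induction hred with
  | refl => exact h
  | tail _ hs ih =>
    cases hs with
    | not =>
      rename_i L₁ L₂ x b
      rw [pathIn_append] at ih ⊢
      rw [mk_pair_flip] at ih
      exact ⟨ih.1, ih.2.2.2⟩

theorem PathIn.invRev {S : Set (Ω × (X × Bool))}
    (hS : ∀ c l, (c, l) ∈ S → (mk [l] • c, flipLetter l) ∈ S) {ω : Ω} {L : List (X × Bool)}
    (h : PathIn S ω L) : PathIn S (mk L • ω) (invRev L) := by
  induction L with
  | nil => simp [PathIn]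
  | cons l L ih =>
    rw [invRev_cons, pathIn_append]
    have e : mk [flipLetter l] • mk (l :: L) • ω = mk L • ω := by
      rw [mk_flipLetter, mk_cons l L, mul_smul, inv_smul_smul]
    refine ⟨by rw [e]; exact ih h.2, ?_, trivial⟩
    rw [← FreeGroup.one_eq_mk, one_smul, mk_cons, mul_smul]
    exact hS _ _ h.1

/-- The darts of a path. -/
def pathDarts (ω : Ω) : List (X × Bool) → Set (Ω × (X × Bool))
  | [] => ∅
  | l :: L => insert (mk L • ω, l) (pathDarts ω L)

theorem finite_pathDarts (ω : Ω) (L : List (X × Bool)) : (pathDarts ω L).Finite := by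
  induction L with
  | nil => exact Set.finite_empty
  | cons l L ih => exact ih.insert _

theorem pathIn_pathDarts (ω : Ω) (L : List (X × Bool)) : PathIn (pathDarts ω L) ω L := by
  induction L with
  | nil => trivial
  | cons l L ih => exact ⟨Set.mem_insert _ _, ih.mono (Set.subset_insert _ _)⟩

/-- A finitely generated stabilizer has finitely many darts on reduced loops. -/
theorem finite_darts (ω : Ω) [Group.FG (MulAction.stabilizer (FreeGroup X) ω)] :
    {p : Ω × (X × Bool) | IsDart ω p.1 p.2}.Finite := by
  classical
  obtain ⟨G, hG⟩ : (MulAction.stabilizer (FreeGroup X) ω).FG := (Group.fg_iff_subgroup_fg _).1 ‹_›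
  let S₀ : Set (Ω × (X × Bool)) := ⋃ g ∈ G, pathDarts ω g.toWord
  have hS₀ : S₀.Finite := G.finite_toSet.biUnion fun g _ => finite_pathDarts ω _
  let fl : Ω × (X × Bool) → Ω × (X × Bool) := fun p => (mk [p.2] • p.1, flipLetter p.2)
  -- Closing under reversal makes the set serve inverses of generators too.
  let S := S₀ ∪ fl '' S₀
  have hS : S.Finite := hS₀.union (hS₀.image fl)
  have hsymm : ∀ c l, (c, l) ∈ S → (mk [l] • c, flipLetter l) ∈ S := by
    rintro c l (h | ⟨⟨c', l'⟩, h, hcl⟩)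
    · exact Or.inr ⟨_, h, rfl⟩
    · left
      simp only [fl, Prod.mk.injEq] at hcl
      obtain ⟨rfl, rfl⟩ := hcl
      rwa [mk_flipLetter, inv_smul_smul, flipLetter_flipLetter]
  have key : ∀ w ∈ Subgroup.closure (G : Set (FreeGroup X)), PathIn S ω w.toWord := by
    intro w hw
    induction hw using Subgroup.closure_induction with
    | mem g hg =>
      refine (pathIn_pathDarts ω g.toWord).mono ?_
      exact (Set.subset_biUnion_of_mem (u := fun g => pathDarts ω g.toWord) hg).trans
        Set.subset_union_left
    | one => simp [PathIn]
    | mul v w hv hw ihv ihw =>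
      rw [FreeGroup.toWord_mul]
      refine PathIn.red FreeGroup.reduce.red ?_
      rw [pathIn_append, FreeGroup.mk_toWord]
      have : w • ω = ω := by rw [hG] at hw; exact hw
      rw [this]
      exact ⟨ihv, ihw⟩
    | inv w hw ih =>
      rw [FreeGroup.toWord_inv]
      have := ih.invRev hsymm
      have hω : w • ω = ω := by rw [hG] at hw; exact hw
      rwa [FreeGroup.mk_toWord, hω] at this
  refine hS.subset ?_
  rintro ⟨c, l⟩ ⟨L₁, L₂, hr, hl, rfl⟩
  have h := key (mk (L₁ ++ l :: L₂)) (by rw [hG]; exact hl)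
  rw [FreeGroup.toWord_mk, hr.reduce_eq, pathIn_append] at h
  exact h.2.1

/-- The same reduced word closes up in both factors. -/
theorem IsDart.prod {Ω' : Type*} [MulAction (FreeGroup X) Ω'] {ω : Ω} {ω' : Ω'} {c : Ω × Ω'}
    {l : X × Bool} (h : IsDart (ω, ω') c l) : IsDart ω c.1 l ∧ IsDart ω' c.2 l := by
  obtain ⟨L₁, L₂, hr, hl, rfl⟩ := h
  exact ⟨⟨L₁, L₂, hr, congrArg Prod.fst hl, rfl⟩, ⟨L₁, L₂, hr, congrArg Prod.snd hl, rfl⟩⟩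

end Darts

/-! ### The finite graph of reduced loops and its Euler characteristic -/

section LoopGraph

open FreeGroup (mk)

variable {X Ω : Type*} [MulAction (FreeGroup X) Ω]

/-- The positively oriented edges on reduced loops. -/
abbrev LoopEdge (X : Type*) {Ω : Type*} [MulAction (FreeGroup X) Ω] (ω : Ω) : Type _ :=
  {p : Ω × X // IsDart ω p.1 (p.2, true)}

/-- The letters, taken from `X₀`, of the darts at a vertex. -/
noncomputable def letters (X₀ : Finset X) (ω c : Ω) : Finset (X × Bool) :=
  open Classical in (X₀ ×ˢ Finset.univ).filter fun l => IsDart ω c l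

theorem mem_letters {X₀ : Finset X} {ω : Ω}
    (hX : ∀ (c : Ω) (l : X × Bool), IsDart ω c l → l.1 ∈ X₀) {c : Ω} {l : X × Bool} :
    l ∈ letters X₀ ω c ↔ IsDart ω c l := by
  simp only [letters, Finset.mem_filter, Finset.mem_product, Finset.mem_univ, and_true]
  exact ⟨fun h => h.2, fun h => ⟨hX c l h, h⟩⟩

theorem letters_subset (X₀ : Finset X) (ω c : Ω) :
    letters X₀ ω c ⊆ X₀ ×ˢ Finset.univ := by
  classical exact Finset.filter_subset _ _

theorem finite_loopVertices {ω : Ω} (h : {p : Ω × (X × Bool) | IsDart ω p.1 p.2}.Finite) :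
    (loopVertices (X := X) ω).Finite :=
  (h.image Prod.fst).subset fun c ⟨l, hl⟩ => ⟨(c, l), hl, rfl⟩

theorem finite_loopEdge {ω : Ω} (h : {p : Ω × (X × Bool) | IsDart ω p.1 p.2}.Finite) :
    Finite (LoopEdge X ω) := by
  have := h.to_subtype
  refine Finite.of_injective
    (β := {p : Ω × (X × Bool) | IsDart ω p.1 p.2}) (fun e => ⟨(e.1.1, e.1.2, true), e.2⟩) ?_
  intro e e' hee
  simp only [Subtype.mk.injEq, Prod.mk.injEq, and_true] at hee
  exact Subtype.ext (Prod.ext hee.1 hee.2)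

/-- Extension by zero of a function on edges. -/
noncomputable def extendEdges (ω : Ω) : (LoopEdge X ω → ℚ) →ₗ[ℚ] (Ω → X → ℚ) where
  toFun f c x := open Classical in
    if h : IsDart ω c (x, true) then f ⟨(c, x), h⟩ else 0
  map_add' f g := by ext c x; by_cases h : IsDart ω c (x, true) <;> simp [h]
  map_smul' r f := by ext c x; by_cases h : IsDart ω c (x, true) <;> simp [h]

/-- Extension by zero of a function on vertices. -/
noncomputable def extendVertices (ω : Ω) :
    (loopVertices (X := X) ω → ℚ) →ₗ[ℚ] (Ω → ℚ) where
  toFun g c := open Classical in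
    if h : c ∈ loopVertices (X := X) ω then g ⟨c, h⟩ else 0
  map_add' f g := by ext c; by_cases h : c ∈ loopVertices (X := X) ω <;> simp [h]
  map_smul' r f := by ext c; by_cases h : c ∈ loopVertices (X := X) ω <;> simp [h]

theorem extendVertices_of_mem {ω : Ω} (g : loopVertices (X := X) ω → ℚ) {c : Ω}
    (h : c ∈ loopVertices (X := X) ω) : extendVertices ω g c = g ⟨c, h⟩ := dif_pos h

/-- The coboundary map of the graph of reduced loops. -/
def loopCoboundary (ω : Ω) :
    (loopVertices (X := X) ω → ℚ) →ₗ[ℚ] (LoopEdge X ω → ℚ) where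
  toFun g e := g ⟨FreeGroup.of e.1.2 • e.1.1, e.2.of_smul_mem⟩ - g ⟨e.1.1, _, e.2⟩
  map_add' f g := by ext e; simp only [Pi.add_apply]; ring
  map_smul' r f := by ext e; simp [mul_sub]

theorem loopIntegral_coboundary (ω : Ω) (g : Ω → ℚ) :
    loopIntegral ω (fun c (x : X) => g (FreeGroup.of x • c) - g c) = 0 := by
  ext ⟨w, hw⟩
  have hw' : w • ω = ω := hw
  rw [loopIntegral_apply, pathIntegral_coboundary, hw', sub_self]
  rfl

theorem loopIntegral_extendEdges (ω : Ω) (f : Ω → X → ℚ) :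
    loopIntegral ω (extendEdges ω fun e => f e.1.1 e.1.2) = loopIntegral ω f :=
  loopIntegral_congr fun _ _ h => dif_pos h

/-- With surjectivity of the integral, this identifies the first cohomology of the loop graph with
the characters of the stabilizer. Integrals see only darts, so extension by zero is harmless. -/
theorem ker_loopIntegral_extendEdges (ω : Ω) :
    LinearMap.ker (loopIntegral ω ∘ₗ extendEdges (X := X) ω) =
      LinearMap.range (loopCoboundary ω) := by
  ext f
  rw [LinearMap.mem_ker, LinearMap.comp_apply, LinearMap.mem_range]
  constructor
  · intro h
    obtain ⟨g, hg⟩ := exists_potential h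
    refine ⟨fun c => g c, funext fun e => ?_⟩
    have := hg e.1.1 (mem_orbit_of_mem_loopVertices ⟨_, e.2⟩) e.1.2
    exact this.symm.trans (dif_pos e.2)
  · rintro ⟨g, rfl⟩
    rw [← loopIntegral_coboundary ω (extendVertices ω g)]
    refine loopIntegral_congr fun c x h => (dif_pos h).trans ?_
    rw [extendVertices_of_mem g h.of_smul_mem, extendVertices_of_mem g ⟨_, h⟩]
    rfl

theorem loopIntegral_extendEdges_surjective (ω : Ω) :
    Function.Surjective (loopIntegral ω ∘ₗ extendEdges (X := X) ω) := fun χ => by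
  obtain ⟨f, rfl⟩ := loopIntegral_surjective ω χ
  exact ⟨_, loopIntegral_extendEdges ω f⟩

theorem finiteDimensional_ratChars_stabilizer {ω : Ω}
    (hfin : {p : Ω × (X × Bool) | IsDart ω p.1 p.2}.Finite) :
    FiniteDimensional ℚ (ratChars (MulAction.stabilizer (FreeGroup X) ω)) := by
  have := finite_loopEdge hfin
  exact Module.Finite.of_surjective _ (loopIntegral_extendEdges_surjective (X := X) ω)

/-- The Euler characteristic of the graph of reduced loops. -/
theorem finrank_ratChars_stabilizer {ω : Ω} (hω : MulAction.stabilizer (FreeGroup X) ω ≠ ⊥)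
    (hfin : {p : Ω × (X × Bool) | IsDart ω p.1 p.2}.Finite) :
    finrank ℚ (ratChars (MulAction.stabilizer (FreeGroup X) ω)) +
      Nat.card (loopVertices (X := X) ω) = Nat.card (LoopEdge X ω) + 1 := by
  have := finite_loopEdge hfin
  have := (finite_loopVertices hfin).to_subtype
  have := Fintype.ofFinite (LoopEdge X ω)
  have := Fintype.ofFinite (loopVertices (X := X) ω)
  have h₁ := LinearMap.finrank_range_add_finrank_ker (loopIntegral ω ∘ₗ extendEdges (X := X) ω)
  rw [LinearMap.range_eq_top.2 (loopIntegral_extendEdges_surjective ω), finrank_top,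
    ker_loopIntegral_extendEdges, Module.finrank_fintype_fun_eq_card] at h₁
  have h₂ := LinearMap.finrank_range_add_finrank_ker (loopCoboundary (X := X) ω)
  rw [Module.finrank_fintype_fun_eq_card] at h₂
  have h₃ : finrank ℚ (LinearMap.ker (loopCoboundary (X := X) ω)) = 1 := by
    have hb := base_mem_loopVertices hω
    refine finrank_eq_one ⟨fun _ => 1, LinearMap.mem_ker.2 (funext fun e => sub_self _)⟩ ?_ ?_
    · intro h
      have := congrFun (congrArg Subtype.val h) ⟨ω, hb⟩
      simp at this
    · rintro ⟨g, hg⟩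
      refine ⟨g ⟨ω, hb⟩, ?_⟩
      ext c
      have := eq_base_of_increments_eq_zero (g := extendVertices ω g) (fun c x h => ?_) c.2
      · rw [extendVertices_of_mem g c.2, extendVertices_of_mem g hb] at this
        simp [this]
      · rw [extendVertices_of_mem g h.of_smul_mem, extendVertices_of_mem g ⟨_, h⟩]
        exact congrFun (LinearMap.mem_ker.1 hg) ⟨(c, x), h⟩
  rw [Nat.card_eq_fintype_card, Nat.card_eq_fintype_card]
  omega

/-- A dart is an edge with an orientation. -/
noncomputable def dartEquiv (ω : Ω) :
    {p : Ω × (X × Bool) // IsDart ω p.1 p.2} ≃ LoopEdge X ω × Bool where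
  toFun p := match p with
    | ⟨(c, (x, true)), h⟩ => (⟨(c, x), h⟩, true)
    | ⟨(c, (x, false)), h⟩ => (⟨(mk [(x, false)] • c, x), h.flip⟩, false)
  invFun e := match e with
    | (⟨(c, x), h⟩, true) => ⟨(c, (x, true)), h⟩
    | (⟨(c, x), h⟩, false) => ⟨(mk [(x, true)] • c, (x, false)), h.flip⟩
  left_inv p := by
    obtain ⟨⟨c, x, _ | _⟩, h⟩ := p
    · have e : mk [(x, false)] = (mk [(x, true)])⁻¹ := mk_flipLetter (x, true)
      simp only [e, smul_inv_smul]
    · rfl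
  right_inv e := by
    obtain ⟨⟨⟨c, x⟩, h⟩, _ | _⟩ := e
    · have e : mk [(x, false)] = (mk [(x, true)])⁻¹ := mk_flipLetter (x, true)
      simp only [e, inv_smul_smul]
    · rfl

theorem sum_card_letters {X₀ : Finset X} {ω : Ω}
    (hX : ∀ (c : Ω) (l : X × Bool), IsDart ω c l → l.1 ∈ X₀)
    [Fintype (loopVertices (X := X) ω)] :
    ∑ c : loopVertices (X := X) ω, (letters X₀ ω c.1).card = 2 * Nat.card (LoopEdge X ω) := by
  let e : (Σ c : loopVertices (X := X) ω, letters X₀ ω c.1) ≃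
      {p : Ω × (X × Bool) // IsDart ω p.1 p.2} :=
    { toFun := fun s => ⟨(s.1.1, s.2.1), (mem_letters hX).1 s.2.2⟩
      invFun := fun p => ⟨⟨p.1.1, _, p.2⟩, p.1.2, (mem_letters hX).2 p.2⟩
      left_inv := fun _ => rfl
      right_inv := fun _ => rfl }
  have h := Nat.card_congr (e.trans (dartEquiv ω))
  rw [Nat.card_prod, Nat.card_eq_fintype_card, Fintype.card_sigma] at h
  simp only [Fintype.card_coe, Nat.card_eq_fintype_card (α := Bool), Fintype.card_bool] at h
  rw [h, mul_comm]

/-- Degrees sum to twice the number of edges, so this is the Euler characteristic formula doubled.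
-/
theorem sum_card_letters_sub_two {X₀ : Finset X} {ω : Ω}
    (hω : MulAction.stabilizer (FreeGroup X) ω ≠ ⊥)
    (hfin : {p : Ω × (X × Bool) | IsDart ω p.1 p.2}.Finite)
    (hX : ∀ (c : Ω) (l : X × Bool), IsDart ω c l → l.1 ∈ X₀)
    [Fintype (loopVertices (X := X) ω)] :
    ∑ c : loopVertices (X := X) ω, ((letters X₀ ω c.1).card - 2 : ℤ) =
      2 * (finrank ℚ (ratChars (MulAction.stabilizer (FreeGroup X) ω)) - 1) := by
  have h₁ := finrank_ratChars_stabilizer hω hfin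
  have h₂ := sum_card_letters hX
  rw [Nat.card_eq_fintype_card] at h₁
  rw [Finset.sum_sub_distrib, ← Nat.cast_sum, h₂]
  simp only [Finset.sum_const, Finset.card_univ, nsmul_eq_mul]
  push_cast
  omega

theorem two_le_card_letters {X₀ : Finset X} {ω : Ω} {L : List (X × Bool)} (hL : L ≠ [])
    (hc : FreeGroup.IsCyclicallyReduced L) (hω : mk L • ω = ω)
    (hX : ∀ (c : Ω) (l : X × Bool), IsDart ω c l → l.1 ∈ X₀)
    (c : loopVertices (X := X) ω) : 2 ≤ (letters X₀ ω c.1).card := by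
  obtain ⟨l, hl⟩ := c.2
  obtain ⟨l', hne, hl'⟩ := exists_ne_isDart hL hc hω hl
  exact Finset.one_lt_card.2 ⟨l, (mem_letters hX).2 hl, l', (mem_letters hX).2 hl', hne.symm⟩

end LoopGraph

/-! ### The glued graph and the characters of the join -/

section Pushout

open FreeGroup (mk)

variable {X Ω₁ Ω₂ : Type*} [MulAction (FreeGroup X) Ω₁] [MulAction (FreeGroup X) Ω₂]

theorem fst_mem_loopVertices {ω₁ : Ω₁} {ω₂ : Ω₂} {c : Ω₁ × Ω₂}
    (h : c ∈ loopVertices (X := X) (ω₁, ω₂)) : c.1 ∈ loopVertices (X := X) ω₁ :=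
  h.imp fun _ hl => hl.prod.1

theorem snd_mem_loopVertices {ω₁ : Ω₁} {ω₂ : Ω₂} {c : Ω₁ × Ω₂}
    (h : c ∈ loopVertices (X := X) (ω₁, ω₂)) : c.2 ∈ loopVertices (X := X) ω₂ :=
  h.imp fun _ hl => hl.prod.2

/-- First projection from vertices of the graph of the intersection. -/
def linkFst (X : Type*) {Ω₁ Ω₂ : Type*} [MulAction (FreeGroup X) Ω₁] [MulAction (FreeGroup X) Ω₂]
    (ω₁ : Ω₁) (ω₂ : Ω₂) (i : loopVertices (X := X) (ω₁, ω₂)) : loopVertices (X := X) ω₁ :=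
  ⟨i.1.1, fst_mem_loopVertices i.2⟩

/-- Second projection from vertices of the graph of the intersection. -/
def linkSnd (X : Type*) {Ω₁ Ω₂ : Type*} [MulAction (FreeGroup X) Ω₁] [MulAction (FreeGroup X) Ω₂]
    (ω₁ : Ω₁) (ω₂ : Ω₂) (i : loopVertices (X := X) (ω₁, ω₂)) : loopVertices (X := X) ω₂ :=
  ⟨i.1.2, snd_mem_loopVertices i.2⟩

/-- The letters at a vertex of the disjoint union of two graphs. -/
noncomputable def sumLetters (X₀ : Finset X) (ω₁ : Ω₁) (ω₂ : Ω₂) :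
    loopVertices (X := X) ω₁ ⊕ loopVertices (X := X) ω₂ → Finset (X × Bool) :=
  Sum.elim (fun c => letters X₀ ω₁ c.1) (fun c => letters X₀ ω₂ c.1)

/-- Functions on the vertices of the glued graph issuing a dart labelled `l`. -/
abbrev dartFunctions (X₀ : Finset X) (ω₁ : Ω₁) (ω₂ : Ω₂) (l : X × Bool) :
    Submodule ℚ (loopVertices (X := X) ω₁ ⊕ loopVertices (X := X) ω₂ → ℚ) :=
  agreeOn (Sum.inl ∘ linkFst X ω₁ ω₂) (Sum.inr ∘ linkSnd X ω₁ ω₂)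
    {v | l ∈ sumLetters X₀ ω₁ ω₂ v} {i | l ∈ letters X₀ (ω₁, ω₂) i.1}

/-- Functions on the vertices of the glued graph. -/
abbrev vertexFunctions (X : Type*) {Ω₁ Ω₂ : Type*} [MulAction (FreeGroup X) Ω₁]
    [MulAction (FreeGroup X) Ω₂] (ω₁ : Ω₁) (ω₂ : Ω₂) :
    Submodule ℚ (loopVertices (X := X) ω₁ ⊕ loopVertices (X := X) ω₂ → ℚ) :=
  agree (Sum.inl ∘ linkFst X ω₁ ω₂) (Sum.inr ∘ linkSnd X ω₁ ω₂) Set.univ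

/-- Moving along the dart with a given letter, where there is one. -/
noncomputable def step {Ω : Type*} [MulAction (FreeGroup X) Ω] (ω : Ω) (l : X × Bool)
    (c : loopVertices (X := X) ω) : loopVertices (X := X) ω :=
  open Classical in if h : IsDart ω c.1 l then ⟨mk [l] • c.1, h.smul_mem⟩ else c

theorem step_of_isDart {Ω : Type*} [MulAction (FreeGroup X) Ω] {ω : Ω} {l : X × Bool}
    {c : loopVertices (X := X) ω} (h : IsDart ω c.1 l) :
    step ω l c = ⟨mk [l] • c.1, h.smul_mem⟩ := dif_pos h

theorem exists_step_eq {Ω : Type*} [MulAction (FreeGroup X) Ω] {ω : Ω} {l : X × Bool}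
    {c : loopVertices (X := X) ω} (h : IsDart ω c.1 (flipLetter l)) :
    ∃ c' : loopVertices (X := X) ω, IsDart ω c'.1 l ∧ step ω l c' = c := by
  have h' := h.flip
  rw [flipLetter_flipLetter] at h'
  refine ⟨⟨_, l, h'⟩, h', ?_⟩
  rw [step_of_isDart h']
  ext
  simp only [mk_flipLetter, smul_inv_smul]

variable {X₀ : Finset X} {ω₁ : Ω₁} {ω₂ : Ω₂}

theorem isDart_prod_fst_mem
    (hX₁ : ∀ (c : Ω₁) (l : X × Bool), IsDart ω₁ c l → l.1 ∈ X₀) (c : Ω₁ × Ω₂) (l : X × Bool)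
    (h : IsDart (ω₁, ω₂) c l) : l.1 ∈ X₀ := hX₁ _ _ h.prod.1

/-- Moving along the dart `l` maps the darts labelled `l` onto those labelled by the inverse letter,
compatibly with the gluing. Applied to both orientations, it shows that edges of the glued graph are
half its darts. -/
theorem finrank_dartFunctions_flip_le [Finite (loopVertices (X := X) ω₁)]
    [Finite (loopVertices (X := X) ω₂)]
    (hX₁ : ∀ (c : Ω₁) (l : X × Bool), IsDart ω₁ c l → l.1 ∈ X₀)
    (hX₂ : ∀ (c : Ω₂) (l : X × Bool), IsDart ω₂ c l → l.1 ∈ X₀) (l : X × Bool) :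
    finrank ℚ (dartFunctions X₀ ω₁ ω₂ (flipLetter l)) ≤
      finrank ℚ (dartFunctions X₀ ω₁ ω₂ l) := by
  refine finrank_agreeOn_le_of_map (Sum.map (step ω₁ l) (step ω₂ l)) ?_ ?_
  · rintro (c | c) hc
    · obtain ⟨c', h₁, h₂⟩ := exists_step_eq ((mem_letters hX₁).1 hc)
      exact ⟨Sum.inl c', (mem_letters hX₁).2 h₁, congrArg Sum.inl h₂⟩
    · obtain ⟨c', h₁, h₂⟩ := exists_step_eq ((mem_letters hX₂).1 hc)
      exact ⟨Sum.inr c', (mem_letters hX₂).2 h₁, congrArg Sum.inr h₂⟩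
  · intro i hi
    have hd := (mem_letters (isDart_prod_fst_mem hX₁)).1 hi
    refine ⟨(mem_letters hX₁).2 hd.prod.1, (mem_letters hX₂).2 hd.prod.2,
      ⟨mk [l] • i.1, hd.smul_mem⟩,
      (mem_letters (isDart_prod_fst_mem hX₁)).2 hd.flip, ?_, ?_⟩
    · exact congrArg Sum.inl (step_of_isDart (c := linkFst X ω₁ ω₂ i) hd.prod.1).symm
    · exact congrArg Sum.inr (step_of_isDart (c := linkSnd X ω₁ ω₂ i) hd.prod.2).symm

theorem sum_finrank_dartFunctions [Finite (loopVertices (X := X) ω₁)]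
    [Finite (loopVertices (X := X) ω₂)]
    (hX₁ : ∀ (c : Ω₁) (l : X × Bool), IsDart ω₁ c l → l.1 ∈ X₀)
    (hX₂ : ∀ (c : Ω₂) (l : X × Bool), IsDart ω₂ c l → l.1 ∈ X₀) :
    ∑ l ∈ X₀ ×ˢ Finset.univ, finrank ℚ (dartFunctions X₀ ω₁ ω₂ l) =
      2 * ∑ x ∈ X₀, finrank ℚ (dartFunctions X₀ ω₁ ω₂ (x, true)) := by
  rw [Finset.sum_product, Finset.mul_sum]
  refine Finset.sum_congr rfl fun x _ => ?_
  rw [Fintype.sum_bool, two_mul]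
  congr 1
  exact le_antisymm (finrank_dartFunctions_flip_le hX₁ hX₂ (x, true))
    (finrank_dartFunctions_flip_le hX₁ hX₂ (x, false))

/-- Extension by zero of a function on edges given label by label. -/
noncomputable def extendLabelled {Ω : Type*} [MulAction (FreeGroup X) Ω] (X₀ : Finset X) (ω : Ω) :
    (X₀ → loopVertices (X := X) ω → ℚ) →ₗ[ℚ] (Ω → X → ℚ) where
  toFun u c x := open Classical in
    if h : x ∈ X₀ ∧ c ∈ loopVertices (X := X) ω then u ⟨x, h.1⟩ ⟨c, h.2⟩ else 0
  map_add' u v := by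
    ext c x
    by_cases h : x ∈ X₀ ∧ c ∈ loopVertices (X := X) ω <;> simp [h]
  map_smul' r u := by
    ext c x
    by_cases h : x ∈ X₀ ∧ c ∈ loopVertices (X := X) ω <;> simp [h]

theorem extendLabelled_of_isDart {Ω : Type*} [MulAction (FreeGroup X) Ω] {ω : Ω}
    (u : X₀ → loopVertices (X := X) ω → ℚ) {c : Ω} {x : X} (hx : x ∈ X₀)
    (h : IsDart ω c (x, true)) : extendLabelled X₀ ω u c x = u ⟨x, hx⟩ ⟨c, _, h⟩ :=
  dif_pos ⟨hx, _, h⟩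

/-- Functions on the edges of the glued graph. -/
abbrev EdgeFunctions (X₀ : Finset X) (ω₁ : Ω₁) (ω₂ : Ω₂) : Type _ :=
  ∀ x : X₀, dartFunctions X₀ ω₁ ω₂ (x.1, true)

/-- Restriction of edge functions to the first graph. -/
def edgeFst (X₀ : Finset X) (ω₁ : Ω₁) (ω₂ : Ω₂) :
    EdgeFunctions X₀ ω₁ ω₂ →ₗ[ℚ] (X₀ → loopVertices (X := X) ω₁ → ℚ) where
  toFun u x c := (u x).1 (Sum.inl c)
  map_add' _ _ := rfl
  map_smul' _ _ := rfl

/-- Restriction of edge functions to the second graph. -/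
def edgeSnd (X₀ : Finset X) (ω₁ : Ω₁) (ω₂ : Ω₂) :
    EdgeFunctions X₀ ω₁ ω₂ →ₗ[ℚ] (X₀ → loopVertices (X := X) ω₂ → ℚ) where
  toFun u x c := (u x).1 (Sum.inr c)
  map_add' _ _ := rfl
  map_smul' _ _ := rfl

/-- The pair of characters defined by an edge function on the glued graph. -/
noncomputable def edgeIntegral (X₀ : Finset X) (ω₁ : Ω₁) (ω₂ : Ω₂) :
    EdgeFunctions X₀ ω₁ ω₂ →ₗ[ℚ] ratChars (MulAction.stabilizer (FreeGroup X) ω₁) ×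
      ratChars (MulAction.stabilizer (FreeGroup X) ω₂) :=
  (loopIntegral ω₁ ∘ₗ extendLabelled X₀ ω₁ ∘ₗ edgeFst X₀ ω₁ ω₂).prod
    (loopIntegral ω₂ ∘ₗ extendLabelled X₀ ω₂ ∘ₗ edgeSnd X₀ ω₁ ω₂)

/-- Moving along the dart with a given letter in a disjoint union of two graphs. -/
noncomputable def sumStep (ω₁ : Ω₁) (ω₂ : Ω₂) (l : X × Bool) :
    loopVertices (X := X) ω₁ ⊕ loopVertices (X := X) ω₂ →
      loopVertices (X := X) ω₁ ⊕ loopVertices (X := X) ω₂ :=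
  Sum.map (step ω₁ l) (step ω₂ l)

/-- The coboundary map of the glued graph. -/
noncomputable def edgeCoboundary
    (hX₁ : ∀ (c : Ω₁) (l : X × Bool), IsDart ω₁ c l → l.1 ∈ X₀)
    (hX₂ : ∀ (c : Ω₂) (l : X × Bool), IsDart ω₂ c l → l.1 ∈ X₀) :
    vertexFunctions X ω₁ ω₂ →ₗ[ℚ] EdgeFunctions X₀ ω₁ ω₂ where
  toFun g x := ⟨fun v => open Classical in if (x.1, true) ∈ sumLetters X₀ ω₁ ω₂ v then
      g.1 (sumStep ω₁ ω₂ (x.1, true) v) - g.1 v else 0, fun v hv => if_neg hv, fun i hi => by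
    have hd := (mem_letters (isDart_prod_fst_mem hX₁)).1 hi
    have h₁ : (x.1, true) ∈ letters X₀ ω₁ (linkFst X ω₁ ω₂ i).1 := (mem_letters hX₁).2 hd.prod.1
    have h₂ : (x.1, true) ∈ letters X₀ ω₂ (linkSnd X ω₁ ω₂ i).1 := (mem_letters hX₂).2 hd.prod.2
    have h₃ := g.2 i trivial
    have h₄ := g.2 ⟨mk [(x.1, true)] • i.1, hd.smul_mem⟩ trivial
    have h₅ := step_of_isDart (c := linkFst X ω₁ ω₂ i) hd.prod.1
    have h₆ := step_of_isDart (c := linkSnd X ω₁ ω₂ i) hd.prod.2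
    refine (if_pos h₁).trans (Eq.trans ?_ (if_pos h₂).symm)
    rw [h₃, sumStep, Function.comp_apply, Function.comp_apply, Sum.map_inl, Sum.map_inr, h₅, h₆]
    exact congrArg (· - _) h₄⟩
  map_add' f g := by
    ext x v
    by_cases h : (x.1, true) ∈ sumLetters X₀ ω₁ ω₂ v
    · simp only [if_pos h, Submodule.coe_add, Pi.add_apply]
      ring
    · simp [h]
  map_smul' r g := by
    ext x v
    by_cases h : (x.1, true) ∈ sumLetters X₀ ω₁ ω₂ v
    · simp [h, mul_sub]
    · simp [h]

theorem edgeIntegral_edgeCoboundary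
    (hX₁ : ∀ (c : Ω₁) (l : X × Bool), IsDart ω₁ c l → l.1 ∈ X₀)
    (hX₂ : ∀ (c : Ω₂) (l : X × Bool), IsDart ω₂ c l → l.1 ∈ X₀) (g : vertexFunctions X ω₁ ω₂) :
    edgeIntegral X₀ ω₁ ω₂ (edgeCoboundary hX₁ hX₂ g) = 0 := by
  refine Prod.ext ?_ ?_
  · rw [Prod.fst_zero, ← loopIntegral_coboundary ω₁ (extendVertices ω₁ fun c => g.1 (Sum.inl c))]
    refine loopIntegral_congr fun c x h => ?_
    have hx : x ∈ X₀ := hX₁ c _ h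
    refine (extendLabelled_of_isDart _ hx h).trans ?_
    rw [extendVertices_of_mem _ h.of_smul_mem, extendVertices_of_mem _ ⟨_, h⟩]
    refine (if_pos ((mem_letters hX₁).2 h)).trans ?_
    exact congrArg (fun v => g.1 (Sum.inl v) - _) (step_of_isDart (c := ⟨c, _, h⟩) h)
  · rw [Prod.snd_zero, ← loopIntegral_coboundary ω₂ (extendVertices ω₂ fun c => g.1 (Sum.inr c))]
    refine loopIntegral_congr fun c x h => ?_
    have hx : x ∈ X₀ := hX₂ c _ h
    refine (extendLabelled_of_isDart _ hx h).trans ?_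
    rw [extendVertices_of_mem _ h.of_smul_mem, extendVertices_of_mem _ ⟨_, h⟩]
    refine (if_pos ((mem_letters hX₂).2 h)).trans ?_
    exact congrArg (fun v => g.1 (Sum.inr v) - _) (step_of_isDart (c := ⟨c, _, h⟩) h)

/-- Each of the two graphs is connected, and their base points are glued because the intersection is
nontrivial; so a function without increments is constant. -/
theorem finrank_ker_edgeCoboundary_le
    (hX₁ : ∀ (c : Ω₁) (l : X × Bool), IsDart ω₁ c l → l.1 ∈ X₀)
    (hX₂ : ∀ (c : Ω₂) (l : X × Bool), IsDart ω₂ c l → l.1 ∈ X₀)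
    (hω : MulAction.stabilizer (FreeGroup X) (ω₁, ω₂) ≠ ⊥) :
    finrank ℚ (LinearMap.ker (edgeCoboundary (ω₁ := ω₁) (ω₂ := ω₂) hX₁ hX₂)) ≤ 1 := by
  have hb := base_mem_loopVertices hω
  have hb₁ := fst_mem_loopVertices hb
  have hb₂ := snd_mem_loopVertices hb
  refine finrank_le_one ⟨⟨fun _ => 1, fun _ _ => rfl⟩, LinearMap.mem_ker.2 ?_⟩ ?_
  · ext x v
    by_cases h : (x.1, true) ∈ sumLetters X₀ ω₁ ω₂ v
    · exact (if_pos h).trans (sub_self _)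
    · exact if_neg h
  · rintro ⟨g, hg⟩
    have hz : ∀ (x : X₀) v, (x.1, true) ∈ sumLetters X₀ ω₁ ω₂ v →
        g.1 (sumStep ω₁ ω₂ (x.1, true) v) - g.1 v = 0 := fun x v hv => by
      have := congrFun (congrArg Subtype.val (congrFun (LinearMap.mem_ker.1 hg) x)) v
      exact (if_pos hv).symm.trans this
    have hbase : g.1 (Sum.inl ⟨ω₁, hb₁⟩) = g.1 (Sum.inr ⟨ω₂, hb₂⟩) := g.2 ⟨_, hb⟩ trivial
    refine ⟨g.1 (Sum.inl ⟨ω₁, hb₁⟩), ?_⟩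
    ext v
    rcases v with v | v
    · have := eq_base_of_increments_eq_zero (g := extendVertices ω₁ fun c => g.1 (Sum.inl c))
        (fun c x h => ?_) v.2
      · rw [extendVertices_of_mem _ v.2, extendVertices_of_mem _ hb₁] at this
        simp [this]
      · rw [extendVertices_of_mem _ h.of_smul_mem, extendVertices_of_mem _ ⟨_, h⟩]
        have := hz ⟨x, hX₁ c _ h⟩ (Sum.inl ⟨c, _, h⟩) ((mem_letters hX₁).2 h)
        rwa [sumStep, Sum.map_inl, step_of_isDart (c := ⟨c, _, h⟩) h] at this
    · have := eq_base_of_increments_eq_zero (g := extendVertices ω₂ fun c => g.1 (Sum.inr c))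
        (fun c x h => ?_) v.2
      · rw [extendVertices_of_mem _ v.2, extendVertices_of_mem _ hb₂, ← hbase] at this
        simp [this]
      · rw [extendVertices_of_mem _ h.of_smul_mem, extendVertices_of_mem _ ⟨_, h⟩]
        have := hz ⟨x, hX₂ c _ h⟩ (Sum.inr ⟨c, _, h⟩) ((mem_letters hX₂).2 h)
        rwa [sumStep, Sum.map_inr, step_of_isDart (c := ⟨c, _, h⟩) h] at this

/-- Restriction of characters to subgroups. -/
def ratCharsOfLE {G : Type*} [Group G] {A B : Subgroup G} (h : A ≤ B) :
    ratChars B →ₗ[ℚ] ratChars A where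
  toFun χ := ⟨fun a => χ.1 ⟨a.1, h a.2⟩, fun s t => χ.2 ⟨s.1, h s.2⟩ ⟨t.1, h t.2⟩⟩
  map_add' _ _ := rfl
  map_smul' _ _ := rfl

/-- Restriction of characters of a join to the two factors. -/
def ratCharsOfSup {G : Type*} [Group G] {A B J : Subgroup G} (hJ : J = A ⊔ B) :
    ratChars J →ₗ[ℚ] ratChars A × ratChars B :=
  (ratCharsOfLE (hJ ▸ le_sup_left)).prod (ratCharsOfLE (hJ ▸ le_sup_right))

theorem ratCharsOfSup_injective {G : Type*} [Group G] {A B J : Subgroup G} (hJ : J = A ⊔ B) :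
    Function.Injective (ratCharsOfSup hJ) := by
  rw [← LinearMap.ker_eq_bot, LinearMap.ker_eq_bot']
  intro χ hχ
  have hA := congrArg Subtype.val (congrArg Prod.fst hχ)
  have hB := congrArg Subtype.val (congrArg Prod.snd hχ)
  have hcl : J = Subgroup.closure (A ∪ B : Set G) := by rw [hJ, Subgroup.sup_eq_closure]
  subst hcl
  ext ⟨x, hx⟩
  show χ.1 ⟨x, hx⟩ = 0
  induction hx using Subgroup.closure_induction with
  | mem x hx =>
    rcases hx with hx | hx
    · exact congrFun hA ⟨x, hx⟩
    · exact congrFun hB ⟨x, hx⟩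
  | one => exact ratChars_one χ
  | mul x y hx hy ihx ihy => exact (ratChars_mul χ ⟨x, hx⟩ ⟨y, hy⟩).trans (by rw [ihx, ihy, add_zero])
  | inv x hx ih => exact (ratChars_inv χ ⟨x, hx⟩).trans (by rw [ih, neg_zero])

/-- Write a character of the join as the integral of an edge function `f` and pull `f` back along
`π₁` and `π₂`. The pullbacks agree along links because linked vertices have the same image. -/
theorem range_ratCharsOfSup_le {Ω : Type*} [MulAction (FreeGroup X) Ω]
    (hX₁ : ∀ (c : Ω₁) (l : X × Bool), IsDart ω₁ c l → l.1 ∈ X₀)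
    (hX₂ : ∀ (c : Ω₂) (l : X × Bool), IsDart ω₂ c l → l.1 ∈ X₀) {ω : Ω}
    (hJ : MulAction.stabilizer (FreeGroup X) ω =
      MulAction.stabilizer (FreeGroup X) ω₁ ⊔ MulAction.stabilizer (FreeGroup X) ω₂)
    (π₁ : Ω₁ → Ω) (hπ₁ : ∀ (w : FreeGroup X) c, π₁ (w • c) = w • π₁ c)
    (π₂ : Ω₂ → Ω) (hπ₂ : ∀ (w : FreeGroup X) c, π₂ (w • c) = w • π₂ c)
    (h₁ : π₁ ω₁ = ω) (h₂ : π₂ ω₂ = ω) :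
    LinearMap.range (ratCharsOfSup hJ) ≤ LinearMap.range (edgeIntegral X₀ ω₁ ω₂) := by
  classical
  rintro _ ⟨χ, rfl⟩
  obtain ⟨f, rfl⟩ := loopIntegral_surjective ω χ
  let p : loopVertices (X := X) ω₁ ⊕ loopVertices (X := X) ω₂ → Ω :=
    Sum.elim (fun c => π₁ c.1) (fun c => π₂ c.1)
  let u : EdgeFunctions X₀ ω₁ ω₂ := fun x =>
    ⟨fun v => if (x.1, true) ∈ sumLetters X₀ ω₁ ω₂ v then f (p v) x.1 else 0,
      fun v hv => if_neg hv, fun i hi => by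
        have hd := (mem_letters (isDart_prod_fst_mem hX₁)).1 hi
        refine (if_pos ((mem_letters hX₁).2 hd.prod.1)).trans
          (Eq.trans ?_ (if_pos ((mem_letters hX₂).2 hd.prod.2)).symm)
        -- A link is a translate of the pair of base points, which have common image `ω`.
        obtain ⟨w, hw⟩ := mem_orbit_of_mem_loopVertices i.2
        have e : π₁ i.1.1 = π₂ i.1.2 := by
          rw [← hw]
          exact (hπ₁ w ω₁).trans ((h₁.trans h₂.symm ▸ rfl : w • π₁ ω₁ = w • π₂ ω₂).trans
            (hπ₂ w ω₂).symm)
        exact congrArg (f · x.1) e⟩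
  refine ⟨u, Prod.ext ?_ ?_⟩
  · have : loopIntegral ω₁ (extendLabelled X₀ ω₁ (edgeFst X₀ ω₁ ω₂ u)) =
        loopIntegral ω₁ fun c x => f (π₁ c) x := by
      refine loopIntegral_congr fun c x h => ?_
      exact (extendLabelled_of_isDart _ (hX₁ c _ h) h).trans (if_pos ((mem_letters hX₁).2 h))
    refine this.trans ?_
    ext w
    rw [loopIntegral_apply, pathIntegral_comp π₁ hπ₁, h₁]
    rfl
  · have : loopIntegral ω₂ (extendLabelled X₀ ω₂ (edgeSnd X₀ ω₁ ω₂ u)) =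
        loopIntegral ω₂ fun c x => f (π₂ c) x := by
      refine loopIntegral_congr fun c x h => ?_
      exact (extendLabelled_of_isDart _ (hX₂ c _ h) h).trans (if_pos ((mem_letters hX₂).2 h))
    refine this.trans ?_
    ext w
    rw [loopIntegral_apply, pathIntegral_comp π₂ hπ₂, h₂]
    rfl

/-- The characters of the join are bounded by the Euler characteristic of the glued graph. -/
theorem finrank_ratChars_sup_le {Ω : Type*} [MulAction (FreeGroup X) Ω]
    [Finite (loopVertices (X := X) ω₁)] [Finite (loopVertices (X := X) ω₂)]
    (hX₁ : ∀ (c : Ω₁) (l : X × Bool), IsDart ω₁ c l → l.1 ∈ X₀)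
    (hX₂ : ∀ (c : Ω₂) (l : X × Bool), IsDart ω₂ c l → l.1 ∈ X₀) {ω : Ω}
    (hω : MulAction.stabilizer (FreeGroup X) (ω₁, ω₂) ≠ ⊥)
    (hJ : MulAction.stabilizer (FreeGroup X) ω =
      MulAction.stabilizer (FreeGroup X) ω₁ ⊔ MulAction.stabilizer (FreeGroup X) ω₂)
    (π₁ : Ω₁ → Ω) (hπ₁ : ∀ (w : FreeGroup X) c, π₁ (w • c) = w • π₁ c)
    (π₂ : Ω₂ → Ω) (hπ₂ : ∀ (w : FreeGroup X) c, π₂ (w • c) = w • π₂ c)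
    (h₁ : π₁ ω₁ = ω) (h₂ : π₂ ω₂ = ω) :
    2 * finrank ℚ (ratChars (MulAction.stabilizer (FreeGroup X) ω)) +
      2 * finrank ℚ (vertexFunctions X ω₁ ω₂) ≤
        ∑ l ∈ X₀ ×ˢ Finset.univ, finrank ℚ (dartFunctions X₀ ω₁ ω₂ l) + 2 := by
  rw [sum_finrank_dartFunctions hX₁ hX₂]
  have e₁ := LinearMap.finrank_range_of_inj (ratCharsOfSup_injective hJ)
  have e₂ := Submodule.finrank_mono (range_ratCharsOfSup_le hX₁ hX₂ hJ π₁ hπ₁ π₂ hπ₂ h₁ h₂)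
  have e₃ := LinearMap.finrank_range_add_finrank_ker (edgeIntegral X₀ ω₁ ω₂)
  have e₄ := LinearMap.finrank_range_add_finrank_ker
    (edgeCoboundary (ω₁ := ω₁) (ω₂ := ω₂) hX₁ hX₂)
  -- Only this inclusion is needed, since the join requires just an upper bound.
  have e₅ : LinearMap.range (edgeCoboundary (ω₁ := ω₁) (ω₂ := ω₂) hX₁ hX₂) ≤
      LinearMap.ker (edgeIntegral X₀ ω₁ ω₂) := by
    rintro _ ⟨g, rfl⟩
    exact LinearMap.mem_ker.2 (edgeIntegral_edgeCoboundary hX₁ hX₂ g)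
  have e₆ := Submodule.finrank_mono e₅
  have e₇ := finrank_ker_edgeCoboundary_le (ω₁ := ω₁) (ω₂ := ω₂) hX₁ hX₂ hω
  rw [Module.finrank_pi_fintype, Finset.sum_coe_sort X₀
    fun x => finrank ℚ (dartFunctions X₀ ω₁ ω₂ (x, true))] at e₃
  omega

end Pushout

/-! ### Assembly of the inequality and reduction to a cyclically reduced word -/

section Main

open FreeGroup (mk)

theorem finrank_ratChars_congr {G : Type*} [Group G] {A B : Subgroup G} (h : A = B) :
    finrank ℚ (ratChars A) = finrank ℚ (ratChars B) := by rw [h]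

theorem stabilizer_prod_quotient {G : Type*} [Group G] (H K : Subgroup G) :
    MulAction.stabilizer G (((1 : G) : G ⧸ H), ((1 : G) : G ⧸ K)) = H ⊓ K := by
  ext g
  have h₁ := SetLike.ext_iff.1 (MulAction.stabilizer_quotient H) g
  have h₂ := SetLike.ext_iff.1 (MulAction.stabilizer_quotient K) g
  rw [MulAction.mem_stabilizer_iff] at h₁ h₂ ⊢
  rw [Subgroup.mem_inf, ← h₁, ← h₂]
  exact Prod.ext_iff

theorem quotientMapOfLE_smul {G : Type*} [Group G] {H J : Subgroup G} (h : H ≤ J) (g : G)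
    (c : G ⧸ H) : Subgroup.quotientMapOfLE h (g • c) = g • Subgroup.quotientMapOfLE h c := by
  induction c using QuotientGroup.induction_on
  rfl

/-- The common cyclically reduced word gives every vertex of all three graphs, base points included,
degree at least two, as discarding two extreme letters requires. -/
theorem rank_inf_sub_one_le_of_isCyclicallyReduced {X : Type*} (H K : Subgroup (FreeGroup X))
    [Group.FG H] [Group.FG K] {L : List (X × Bool)} (hL : L ≠ [])
    (hc : FreeGroup.IsCyclicallyReduced L) (hLH : mk L ∈ H) (hLK : mk L ∈ K)
    (hle : Group.rank H ≤ Group.rank K) :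
    ∃ (_ : Group.FG (H ⊓ K : Subgroup (FreeGroup X)))
      (_ : Group.FG (H ⊔ K : Subgroup (FreeGroup X))),
      (Group.rank (H ⊓ K : Subgroup (FreeGroup X)) : ℤ) - 1 ≤
        2 * ((Group.rank H : ℤ) - 1) * ((Group.rank K : ℤ) - 1) -
          ((Group.rank H : ℤ) - 1) *
            ((Group.rank (H ⊔ K : Subgroup (FreeGroup X)) : ℤ) - 1) := by
  classical
  let ω₁ : FreeGroup X ⧸ H := ((1 : FreeGroup X) : FreeGroup X ⧸ H)
  let ω₂ : FreeGroup X ⧸ K := ((1 : FreeGroup X) : FreeGroup X ⧸ K)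
  have s₁ : MulAction.stabilizer (FreeGroup X) ω₁ = H := MulAction.stabilizer_quotient H
  have s₂ : MulAction.stabilizer (FreeGroup X) ω₂ = K := MulAction.stabilizer_quotient K
  have s₃ : MulAction.stabilizer (FreeGroup X) (ω₁, ω₂) = H ⊓ K := stabilizer_prod_quotient H K
  have hL₁ : mk L • ω₁ = ω₁ := by rw [← MulAction.mem_stabilizer_iff, s₁]; exact hLH
  have hL₂ : mk L • ω₂ = ω₂ := by rw [← MulAction.mem_stabilizer_iff, s₂]; exact hLK
  have hL₃ : mk L • (ω₁, ω₂) = (ω₁, ω₂) := Prod.ext hL₁ hL₂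
  have hL1 : mk L ≠ 1 := fun h => hL (by
    have := FreeGroup.toWord_eq_nil_iff.2 h
    rwa [FreeGroup.toWord_mk, hc.isReduced.reduce_eq] at this)
  have n₁ : MulAction.stabilizer (FreeGroup X) ω₁ ≠ ⊥ := fun h => hL1 (by
    rw [← Subgroup.mem_bot, ← h]; exact hL₁)
  have n₂ : MulAction.stabilizer (FreeGroup X) ω₂ ≠ ⊥ := fun h => hL1 (by
    rw [← Subgroup.mem_bot, ← h]; exact hL₂)
  have n₃ : MulAction.stabilizer (FreeGroup X) (ω₁, ω₂) ≠ ⊥ := fun h => hL1 (by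
    rw [← Subgroup.mem_bot, ← h]; exact hL₃)
  have : Group.FG (MulAction.stabilizer (FreeGroup X) ω₁) := by rw [s₁]; infer_instance
  have : Group.FG (MulAction.stabilizer (FreeGroup X) ω₂) := by rw [s₂]; infer_instance
  have f₁ := finite_darts (X := X) ω₁
  have f₂ := finite_darts (X := X) ω₂
  -- This finiteness is what yields finite generation of the intersection.
  have f₃ : {p : (_ × _) × (X × Bool) | IsDart (ω₁, ω₂) p.1 p.2}.Finite := by
    refine ((f₁.prod f₂).image fun q => ((q.1.1, q.2.1), q.1.2)).subset ?_
    rintro ⟨⟨c₁, c₂⟩, l⟩ h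
    exact ⟨((c₁, l), (c₂, l)), ⟨h.prod.1, h.prod.2⟩, rfl⟩
  -- The basis may be infinite, but only finitely many letters occur.
  let X₀ : Finset X := f₁.toFinset.image (fun p => p.2.1) ∪ f₂.toFinset.image fun p => p.2.1
  have hX₁ : ∀ c (l : X × Bool), IsDart ω₁ c l → l.1 ∈ X₀ := fun c l h =>
    Finset.mem_union_left _ (Finset.mem_image.2 ⟨(c, l), f₁.mem_toFinset.2 h, rfl⟩)
  have hX₂ : ∀ c (l : X × Bool), IsDart ω₂ c l → l.1 ∈ X₀ := fun c l h =>
    Finset.mem_union_right _ (Finset.mem_image.2 ⟨(c, l), f₂.mem_toFinset.2 h, rfl⟩)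
  have hX₃ := isDart_prod_fst_mem (ω₂ := ω₂) hX₁
  have := (finite_loopVertices f₁).to_subtype
  have := (finite_loopVertices f₂).to_subtype
  have := (finite_loopVertices f₃).to_subtype
  have := Fintype.ofFinite (loopVertices (X := X) ω₁)
  have := Fintype.ofFinite (loopVertices (X := X) ω₂)
  have := Fintype.ofFinite (loopVertices (X := X) (ω₁, ω₂))
  have d₃ : FiniteDimensional ℚ (ratChars (H ⊓ K : Subgroup (FreeGroup X))) :=
    s₃ ▸ finiteDimensional_ratChars_stabilizer f₃
  have fgI : Group.FG (H ⊓ K : Subgroup (FreeGroup X)) := fg_of_finiteDimensional_ratChars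
  have fgJ : Group.FG (H ⊔ K : Subgroup (FreeGroup X)) :=
    (Group.fg_iff_subgroup_fg _).2
      (((Group.fg_iff_subgroup_fg H).1 ‹_›).sup ((Group.fg_iff_subgroup_fg K).1 ‹_›))
  refine ⟨fgI, fgJ, ?_⟩
  let ω : FreeGroup X ⧸ (H ⊔ K) := ((1 : FreeGroup X) : FreeGroup X ⧸ (H ⊔ K))
  have s : MulAction.stabilizer (FreeGroup X) ω = H ⊔ K := MulAction.stabilizer_quotient _
  have hJ := finrank_ratChars_sup_le (ω₁ := ω₁) (ω₂ := ω₂) (ω := ω) hX₁ hX₂ n₃ (by rw [s, s₁, s₂])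
    (Subgroup.quotientMapOfLE le_sup_left) (quotientMapOfLE_smul _)
    (Subgroup.quotientMapOfLE le_sup_right) (quotientMapOfLE_smul _) rfl rfl
  have c₁ := sum_card_letters_sub_two n₁ f₁ hX₁
  have c₂ := sum_card_letters_sub_two n₂ f₂ hX₂
  have c₃ := sum_card_letters_sub_two n₃ f₃ hX₃
  rw [finrank_ratChars_congr s₁, ← rank_eq_finrank_ratChars] at c₁
  rw [finrank_ratChars_congr s₂, ← rank_eq_finrank_ratChars] at c₂
  rw [finrank_ratChars_congr s₃, ← rank_eq_finrank_ratChars] at c₃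
  rw [finrank_ratChars_congr s, ← rank_eq_finrank_ratChars] at hJ
  -- Any order will do, provided it is the same at all vertices.
  let _ : LinearOrder (X × Bool) := IsWellOrder.linearOrder WellOrderingRel
  have key := sum_card_sub_two_add_mul_le (linkFst X ω₁ ω₂) (linkSnd X ω₁ ω₂)
    (fun i i' h h' => Subtype.ext (Prod.ext (congrArg Subtype.val h) (congrArg Subtype.val h')))
    (X₀ ×ˢ Finset.univ) (fun c => letters X₀ ω₁ c.1) (fun c => letters X₀ ω₂ c.1)
    (fun i => letters X₀ (ω₁, ω₂) i.1) (fun c => letters_subset _ _ _)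
    (fun c => letters_subset _ _ _) (two_le_card_letters hL hc hL₁ hX₁)
    (two_le_card_letters hL hc hL₂ hX₂) (two_le_card_letters hL hc hL₃ hX₃)
    (fun i l hl => (mem_letters hX₁).2 ((mem_letters hX₃).1 hl).prod.1)
    (fun i l hl => (mem_letters hX₂).2 ((mem_letters hX₃).1 hl).prod.2)
    (by rw [c₁, c₂]; omega) (Group.rank (H ⊔ K : Subgroup (FreeGroup X)) - 1) (by
      have h' := Nat.cast_le (α := ℤ).2 hJ
      rw [Nat.cast_add, Nat.cast_add, Nat.cast_mul, Nat.cast_mul] at h'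
      have h'' : 2 * ((Group.rank (H ⊔ K : Subgroup (FreeGroup X)) : ℤ) - 1) +
          2 * (finrank ℚ (vertexFunctions X ω₁ ω₂) : ℤ) ≤
          ((∑ l ∈ X₀ ×ˢ Finset.univ, finrank ℚ (dartFunctions X₀ ω₁ ω₂ l) : ℕ) : ℤ) := by
        push_cast at h' ⊢
        linarith
      exact h'')
  rw [c₁, c₂, c₃] at key
  linarith

/-- Conjugation is an automorphism, so it preserves ranks, intersections and joins while turning a
chosen nontrivial element into its cyclic reduction. -/
theorem exists_mulEquiv_isCyclicallyReduced {F : Type*} [Group F] [IsFreeGroup F] {w : F}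
    (hw : w ≠ 1) : ∃ (f : F ≃* FreeGroup (IsFreeGroup.Generators F))
      (L : List (IsFreeGroup.Generators F × Bool)),
      L ≠ [] ∧ FreeGroup.IsCyclicallyReduced L ∧ f w = mk L := by
  classical
  let e := IsFreeGroup.toFreeGroup F
  let L := (e w).toWord
  let g := mk (FreeGroup.reduceCyclically.conjugator L)
  have hL : e w = g * mk (FreeGroup.reduceCyclically L) * g⁻¹ := by
    rw [FreeGroup.inv_mk, FreeGroup.mul_mk, FreeGroup.mul_mk,
      FreeGroup.reduceCyclically.conj_conjugator_reduceCyclically, FreeGroup.mk_toWord]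
  refine ⟨e.trans (MulAut.conj g⁻¹), FreeGroup.reduceCyclically L, fun h => ?_,
    FreeGroup.reduceCyclically.isCyclicallyReduced FreeGroup.isReduced_toWord, ?_⟩
  · rw [h, ← FreeGroup.one_eq_mk, mul_one, mul_inv_cancel] at hL
    exact hw (e.map_eq_one_iff.1 hL)
  · rw [MulEquiv.trans_apply, hL, MulAut.conj_apply]
    group

theorem theorem1p2 {F : Type*} [Group F] [IsFreeGroup F] (H K : Subgroup F)
    [Group.FG H] [Group.FG K] (hH : H ≠ ⊥) (hK : K ≠ ⊥) (h k : ℕ)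
    (hh : Group.rank H = h) (hk : Group.rank K = k) (hle : h ≤ k)
    (hHK : H ⊓ K ≠ ⊥) :
    ∃ (_ : Group.FG (H ⊓ K : Subgroup F)) (_ : Group.FG (H ⊔ K : Subgroup F)),
      (Group.rank (H ⊓ K : Subgroup F) : ℤ) - 1 ≤
        2 * ((h : ℤ) - 1) * ((k : ℤ) - 1) -
          ((h : ℤ) - 1) * ((Group.rank (H ⊔ K : Subgroup F) : ℤ) - 1) := by
  obtain ⟨w, hw, hw1⟩ := (Subgroup.bot_or_exists_ne_one _).resolve_left hHK
  obtain ⟨f, L, hL, hc, hfw⟩ := exists_mulEquiv_isCyclicallyReduced hw1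
  have hf : Function.Injective f.toMonoidHom := f.injective
  let em : ∀ A : Subgroup F, A ≃* A.map f.toMonoidHom := fun A => A.equivMapOfInjective _ hf
  have : Group.FG (H.map f.toMonoidHom) :=
    Group.fg_of_surjective (f := (em H).toMonoidHom) (em H).surjective
  have : Group.FG (K.map f.toMonoidHom) :=
    Group.fg_of_surjective (f := (em K).toMonoidHom) (em K).surjective
  have rH := Group.rank_congr (em H)
  have rK := Group.rank_congr (em K)
  obtain ⟨fgI, fgJ, hmain⟩ := rank_inf_sub_one_le_of_isCyclicallyReduced
    (H.map f.toMonoidHom) (K.map f.toMonoidHom) hL hc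
    (hfw ▸ Subgroup.mem_map_of_mem f.toMonoidHom hw.1)
    (hfw ▸ Subgroup.mem_map_of_mem f.toMonoidHom hw.2) (by omega)
  let eI := (em (H ⊓ K)).trans (MulEquiv.subgroupCongr (Subgroup.map_inf H K _ hf))
  let eJ := (em (H ⊔ K)).trans (MulEquiv.subgroupCongr (Subgroup.map_sup H K _))
  have fgI' : Group.FG (H ⊓ K : Subgroup F) :=
    Group.fg_of_surjective (f := eI.symm.toMonoidHom) eI.symm.surjective
  have fgJ' : Group.FG (H ⊔ K : Subgroup F) :=
    Group.fg_of_surjective (f := eJ.symm.toMonoidHom) eJ.symm.surjective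
  refine ⟨fgI', fgJ', ?_⟩
  rw [Group.rank_congr eI, Group.rank_congr eJ, ← hh, ← hk, rH, rK]
  exact hmain

end Main
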